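/- Let $K\ge 2$ be an integer and let $X$ be a regular $K$-ary tree, i.e. a rooted tree with root $0$ in which every vertex has exactly $K$ children, regarded as a metric graph with edges of length one; let $|x|$ be the distance from $0$ to $x\in X$ and $d|x|$ the length measure. Fix $\varepsilon>0$, $\beta>\log K$ and $1\le p<\infty$, and equip $X$ with the metric $d_X(x,y)=\int_{[x,y]}e^{-\varepsilon|z|}\,d|z|$, where $[x,y]$ is the geodesic from $x$ to $y$, and with the measure $d\mu(x)=e^{-\beta|x|}\,d|x|$. A Borel function $g:X\to[0,\infty]$ is an upper gradient of $f:X\to\mathbb R$ if $|f(x)-f(y)|\le\int_{[x,y]}g(z)\,e^{-\varepsilon|z|}\,d|z|$ for all $x,y\in X$; the space $N^{1,p}(X)$ consists of all (measurable) $f:X\to\mathbb R$ with $$\|f\|_{N^{1,p}(X)}=\Bigl(\int_X|f|^p\,d\mu+\inf_g\int_X g^p\,d\mu\Bigr)^{1/p}<\infty,$$ the infimum being over all upper gradients $g$ of $f$. The boundary $\partial X$ is the set of infinite geodesics starting at $0$, with the metric $d_X(\zeta,\xi)=\frac2\varepsilon e^{-\varepsilon k}$ for $\zeta\ne\xi$,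 where $k$ is the level of the last common vertex of $\zeta$ and $\xi$. Let $\nu$ be the Hausdorff measure of dimension $(\log K)/\varepsilon$ on $\partial X$, normalized to total mass $1$. For $\theta>0$, $B^\theta_{p,p}(\partial X)$ is the space of all $u\in L^p(\partial X,\nu)$ with $$\|u\|_{B^\theta_{p,p}(\partial X)}=\Bigl(\int_0^\infty t^{-\theta p}\int_{\partial X}\frac1{\nu(B(\zeta,t))}\int_{B(\zeta,t)}|u(\zeta)-u(\xi)|^p\,d\nu(\xi)\,d\nu(\zeta)\,\frac{dt}t\Bigr)^{1/p}<\infty,$$ where $B(\zeta,t)$ is the open ball in $\partial X$, and it is normed by $\|u\|_{L^p(\partial X)}+\|u\|_{B^\theta_{p,p}(\partial X)}$. A function $u:\partial X\to\mathbb R$ is the trace of $f:X\to\mathbb R$, written $u=\operatorname{Tr}f$, if for $\nu$-a.e. $\zeta\in\partial X$ the limit of $f(x)$ as $x\to\zeta$ along the geodesic ray $[0,\zeta)$ exists and equals $u(\zeta)$. Theorem. Assume that $\theta:=1-\dfrac{\beta-\log K}{p\varepsilon}>0$. Then every $f\in N^{1,p}(X)$ has a trace, and the trace space $\{\operatorname{Tr}f:f\in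 N^{1,p}(X)\}$ is exactly $B^\theta_{p,p}(\partial X)$, with equivalent norms: there is a constant $C$ such that, for every $u\in B^\theta_{p,p}(\partial X)$, $$\frac1C\bigl(\|u\|_{L^p(\partial X)}+\|u\|_{B^\theta_{p,p}(\partial X)}\bigr)\le\inf\{\|f\|_{N^{1,p}(X)}:f\in N^{1,p}(X),\ \operatorname{Tr}f=u\}\le C\bigl(\|u\|_{L^p(\partial X)}+\|u\|_{B^\theta_{p,p}(\partial X)}\bigr).$$ -/

import Mathlib

open Set Filter Topology MeasureTheory
open scoped NNReal ENNReal

noncomputable section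

namespace KTree

variable {V : Type*}

/-- `(G, o)` is a regular `K`-ary rooted tree: `G` is a tree, `o` is its root, and every vertex `x`
has exactly `K` children, i.e. neighbours that are one edge further away from the root. -/
def IsKaryTree (G : SimpleGraph V) (o : V) (K : ℕ) : Prop :=
  G.IsTree ∧ ∀ x : V, {y | G.Adj x y ∧ G.dist o y = G.dist o x + 1}.encard = K

/-! ### The metric tree `X` -/

/-- The points of the metric tree `X`, every edge of which is a copy of the unit interval.
A point different from the root lies on exactly one half-open edge, from the parent of a
vertex `vert` (excluded) to `vert` (included); it is recorded by `vert` and by its distance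
`height` from the root (written `|x|`), so that `|vert| - 1 < height ≤ |vert|`.
The root is `(o, 0)`. Both cases are covered by `⌈height⌉₊ = |vert|`. -/
@[ext]
structure Point (G : SimpleGraph V) (o : V) where
  vert : V
  height : ℝ
  height_nonneg : 0 ≤ height
  ceil_height : ⌈height⌉₊ = G.dist o vert

/-- The root, as a point of `X`. -/
def Point.root (G : SimpleGraph V) (o : V) : Point G o := ⟨o, 0, le_rfl, by simp⟩

/-- The Borel σ-algebra of `X`: since `X` has countably many edges, a set is Borel exactly when its
trace on each edge is a Borel set of heights. -/
instance (G : SimpleGraph V) (o : V) : MeasurableSpace (Point G o) :=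
  MeasurableSpace.comap (fun x : Point G o => (x.vert, x.height))
    (@Prod.instMeasurableSpace V ℝ ⊤ inferInstance)

variable {G : SimpleGraph V} {o : V}

/-- `x ≤ y`: the point `x` lies on the geodesic from the root to `y`. -/
def Point.Anc (x y : Point G o) : Prop :=
  x.height ≤ y.height ∧ G.dist o x.vert + G.dist x.vert y.vert = G.dist o y.vert

/-- The geodesic `[x, y]` in `X`: the points `z` on the geodesic from the root to `x` or to `y`
that are not strictly closer to the root than the last common ancestor of `x` and `y`. -/
def geodesic (x y : Point G o) : Set (Point G o) :=
  {z | (z.Anc x ∨ z.Anc y) ∧ ∀ w : Point G o, w.Anc x → w.Anc y → w.Anc z}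

/-- The point at height `t` on the edge that ends in `v` (the root if there is no such point). -/
def edgePoint (G : SimpleGraph V) (o v : V) (t : ℝ) : Point G o :=
  haveI := Classical.propDecidable (0 ≤ t ∧ ⌈t⌉₊ = G.dist o v)
  if h : 0 ≤ t ∧ ⌈t⌉₊ = G.dist o v then ⟨v, t, h.1, h.2⟩ else Point.root G o

/-- The length measure `d|x|`, which is Lebesgue measure (of total mass one) on each edge. -/
def lengthMeasure (G : SimpleGraph V) (o : V) : Measure (Point G o) :=
  Measure.sum fun v : {v : V // v ≠ o} =>
    (volume.restrict (Ioc ((G.dist o v : ℝ) - 1) (G.dist o v))).map (edgePoint G o v)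

/-- The measure `dμ(x) = e^{-β|x|} d|x|` on `X`. -/
def treeMeasure (G : SimpleGraph V) (o : V) (β : ℝ) : Measure (Point G o) :=
  (lengthMeasure G o).withDensity fun x => ENNReal.ofReal (Real.exp (-β * x.height))

/-- `∫_[x,y] g d_X s`, where `d_X s = e^{-ε|z|} d|z|` is the arc length of the uniformizing metric
`d_X(x, y) = ∫_[x,y] e^{-ε|z|} d|z|`. -/
def lineIntegral (ε : ℝ) (g : Point G o → ℝ≥0∞) (x y : Point G o) : ℝ≥0∞ :=
  ∫⁻ z in geodesic x y, g z * ENNReal.ofReal (Real.exp (-ε * z.height)) ∂lengthMeasure G o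

/-- The Borel function `g : X → [0, ∞]` is an upper gradient of `f`, with respect to `d_X`. -/
def IsUpperGradient (ε : ℝ) (f : Point G o → ℝ) (g : Point G o → ℝ≥0∞) : Prop :=
  Measurable g ∧ ∀ x y, ENNReal.ofReal |f x - f y| ≤ lineIntegral ε g x y

/-- The norm `(∫ |f|^p dμ + inf_g ∫ g^p dμ)^{1/p}` of the Newtonian space `N^{1,p}(X)`, where `g`
runs over the upper gradients of `f`. -/
def newtonNorm (ε β p : ℝ) (f : Point G o → ℝ) : ℝ≥0∞ :=
  ((∫⁻ x, ENNReal.ofReal |f x| ^ p ∂treeMeasure G o β) +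
    ⨅ (g : Point G o → ℝ≥0∞) (_ : IsUpperGradient ε f g), ∫⁻ x, g x ^ p ∂treeMeasure G o β)
      ^ (1 / p)

/-- The Newtonian space `N^{1,p}(X)`. -/
def newtonSpace (G : SimpleGraph V) (o : V) (ε β p : ℝ) : Set (Point G o → ℝ) :=
  {f | AEMeasurable f (treeMeasure G o β) ∧ newtonNorm ε β p f < ∞}

/-! ### The boundary `∂X` -/

/-- The boundary `∂X`: the infinite geodesics `ζ = ζ₀ ζ₁ ζ₂ …` in the tree that start at the root.
(It carries a metric that depends on `ε`.) -/
@[ext]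
structure Boundary (G : SimpleGraph V) (o : V) (ε : ℝ) where
  vertex : ℕ → V
  adj : ∀ i, G.Adj (vertex i) (vertex (i + 1))
  dist_vertex : ∀ i, G.dist o (vertex i) = i
  vertex_zero : vertex 0 = o

variable {ε : ℝ}

/-- The number of edges from the root to the geodesic `[ζ, ξ]` (for `ζ ≠ ξ`), i.e. the level of the
last common vertex of `ζ` and `ξ`. -/
def Boundary.level (ζ ξ : Boundary G o ε) : ℕ := PiNat.firstDiff ζ.vertex ξ.vertex - 1

/-- The visual metric on `∂X`: the distance between `ζ ≠ ξ` is
`2 ∫_k^∞ e^{-εt} dt = (2/ε) e^{-εk}`, where `k` is the number of edges from the root to `[ζ, ξ]`. -/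
instance : Dist (Boundary G o ε) where
  dist ζ ξ :=
    haveI := Classical.propDecidable (ζ = ξ)
    if ζ = ξ then 0 else 2 / ε * Real.exp (-ε * ζ.level ξ)

theorem Boundary.dist_self' (ζ : Boundary G o ε) : dist ζ ζ = 0 := by simp [dist]

theorem Boundary.dist_of_ne {ζ ξ : Boundary G o ε} (h : ζ ≠ ξ) :
    dist ζ ξ = 2 / ε * Real.exp (-ε * ζ.level ξ) := by simp [dist, h]

theorem Boundary.dist_comm' (ζ ξ : Boundary G o ε) : dist ζ ξ = dist ξ ζ := by
  by_cases h : ζ = ξ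
  · rw [h]
  · rw [dist_of_ne h, dist_of_ne (Ne.symm h), level, level, PiNat.firstDiff_comm]

theorem Boundary.dist_pos_of_ne [hε : Fact (0 < ε)] {ζ ξ : Boundary G o ε} (h : ζ ≠ ξ) :
    0 < dist ζ ξ := by
  rw [dist_of_ne h]
  have := hε.out
  positivity

theorem Boundary.dist_nonneg' [Fact (0 < ε)] (ζ ξ : Boundary G o ε) : 0 ≤ dist ζ ξ := by
  by_cases h : ζ = ξ
  · rw [h, dist_self']
  · exact (dist_pos_of_ne h).le

theorem Boundary.dist_le_max [hε : Fact (0 < ε)] (ζ ξ η : Boundary G o ε) :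
    dist ζ η ≤ max (dist ζ ξ) (dist ξ η) := by
  by_cases h1 : ζ = ξ
  · subst h1; exact le_max_right _ _
  by_cases h2 : ξ = η
  · subst h2; exact le_max_left _ _
  by_cases h3 : ζ = η
  · subst h3; rw [dist_self']; exact le_max_of_le_left (dist_nonneg' _ _)
  have hne : ζ.vertex ≠ η.vertex := fun h => h3 (Boundary.ext h)
  have hmin := PiNat.min_firstDiff_le ζ.vertex ξ.vertex η.vertex hne
  have hε0 := hε.out
  have key : ∀ {a b : ℕ}, a ≤ b →
      2 / ε * Real.exp (-ε * (b : ℝ)) ≤ 2 / ε * Real.exp (-ε * (a : ℝ)) := by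
    intro a b hab
    have : (a : ℝ) ≤ b := by exact_mod_cast hab
    gcongr 2 / ε * Real.exp ?_
    nlinarith
  rw [dist_of_ne h1, dist_of_ne h2, dist_of_ne h3]
  rcases min_le_iff.mp hmin with h | h
  · exact le_max_of_le_left (key (Nat.sub_le_sub_right h 1))
  · exact le_max_of_le_right (key (Nat.sub_le_sub_right h 1))

instance [Fact (0 < ε)] : MetricSpace (Boundary G o ε) where
  dist_self := Boundary.dist_self'
  dist_comm := Boundary.dist_comm'
  dist_triangle ζ ξ η := by
    have h := Boundary.dist_le_max ζ ξ η
    have h1 := Boundary.dist_nonneg' ζ ξ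
    have h2 := Boundary.dist_nonneg' ξ η
    exact h.trans (max_le (by linarith) (by linarith))
  eq_of_dist_eq_zero := by
    intro ζ ξ h
    by_contra hne
    exact (Boundary.dist_pos_of_ne hne).ne' h

instance [Fact (0 < ε)] : MeasurableSpace (Boundary G o ε) := borel _

instance [Fact (0 < ε)] : BorelSpace (Boundary G o ε) := ⟨rfl⟩

/-- The normalized Hausdorff measure `ν` on the boundary of a `K`-ary tree, of dimension
`Q = log K / ε`. -/
def boundaryMeasure (G : SimpleGraph V) (o : V) (K : ℕ) (ε : ℝ) [Fact (0 < ε)] :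
    Measure (Boundary G o ε) :=
  (Measure.hausdorffMeasure (Real.log K / ε) (univ : Set (Boundary G o ε)))⁻¹ •
    Measure.hausdorffMeasure (Real.log K / ε)

/-! ### Besov spaces on `∂X` -/

/-- `E_p(u, t)`, the `p`-th root of
`∫ (average over ξ in the open ball B(ζ, t) of |u(ζ) - u(ξ)|^p) dν(ζ)`. -/
def besovE [Fact (0 < ε)] (K : ℕ) (p : ℝ) (u : Boundary G o ε → ℝ) (t : ℝ) : ℝ≥0∞ :=
  (∫⁻ ζ, (⨍⁻ ξ in Metric.ball ζ t, ENNReal.ofReal |u ζ - u ξ| ^ p ∂boundaryMeasure G o K ε)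
    ∂boundaryMeasure G o K ε) ^ (1 / p)

/-- The Besov seminorm `(∫_0^∞ (E_p(u, t) / t^θ)^q dt/t)^{1/q}`. -/
def besovSeminorm [Fact (0 < ε)] (K : ℕ) (θ p q : ℝ) (u : Boundary G o ε → ℝ) : ℝ≥0∞ :=
  (∫⁻ t in Ioi (0 : ℝ), (besovE K p u t / ENNReal.ofReal (t ^ θ)) ^ q / ENNReal.ofReal t)
    ^ (1 / q)

/-- The Besov norm `‖u‖_{L^p(∂X)} + ‖u‖_{B^θ_{p,q}(∂X)}`. -/
def besovNorm [Fact (0 < ε)] (K : ℕ) (θ p q : ℝ) (u : Boundary G o ε → ℝ) : ℝ≥0∞ :=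
  eLpNorm u (ENNReal.ofReal p) (boundaryMeasure G o K ε) + besovSeminorm K θ p q u

/-- The Besov space `B^θ_{p,q}(∂X)`. -/
def besovSpace (G : SimpleGraph V) (o : V) (K : ℕ) (ε : ℝ) [Fact (0 < ε)] (θ p q : ℝ) :
    Set (Boundary G o ε → ℝ) :=
  {u | MemLp u (ENNReal.ofReal p) (boundaryMeasure G o K ε) ∧ besovSeminorm K θ p q u < ∞}

/-! ### Traces -/

/-- The point at height `t` on the geodesic ray `[0, ζ)`. -/
def Boundary.ray (ζ : Boundary G o ε) (t : ℝ≥0) : Point G o :=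
  ⟨ζ.vertex ⌈(t : ℝ)⌉₊, t, t.2, (ζ.dist_vertex _).symm⟩

/-- `Tr f = u`: for `ν`-almost every `ζ`, the limit of `f(x)` as `x → ζ` along the geodesic ray
`[0, ζ)` exists and equals `u(ζ)`. -/
def IsTrace [Fact (0 < ε)] (K : ℕ) (f : Point G o → ℝ) (u : Boundary G o ε → ℝ) : Prop :=
  ∀ᵐ ζ ∂boundaryMeasure G o K ε, Tendsto (fun t : ℝ≥0 => f (ζ.ray t)) atTop (𝓝 (u ζ))

/-- The trace space of `N^{1,p}(X)` on `∂X`. -/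
def traceSpace (G : SimpleGraph V) (o : V) (K : ℕ) (ε : ℝ) [Fact (0 < ε)] (β p : ℝ) :
    Set (Boundary G o ε → ℝ) :=
  {u | ∃ f ∈ newtonSpace G o ε β p, IsTrace K f u}

/-- The norm of the trace space: the infimum of `‖f‖_{N^{1,p}(X)}` over all `f` in `N^{1,p}(X)`
with trace `u`. -/
def traceNorm [Fact (0 < ε)] (K : ℕ) (β p : ℝ) (u : Boundary G o ε → ℝ) : ℝ≥0∞ :=
  ⨅ (f : Point G o → ℝ) (_ : f ∈ newtonSpace G o ε β p ∧ IsTrace K f u), newtonNorm ε β p f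

end KTree

end

/-! Everything is reduced to sums over the levels of the tree. The cylinder of rays through a vertex
of level `n` has `ν`-mass `K⁻ⁿ` (`boundaryMeasure_cylinder`) and is the open ball of every radius in
`((2/ε)e^{-εn}, (2/ε)e^{-ε(n-1)}]` about each of its points. Hence the `p`-th power of the Besov
seminorm is comparable to `∑ e^{θpεn} oscₙ`, where `oscₙ` is the mean oscillation of `u` over the
cylinders of level `n` (`besovSeminorm_rpow_le`, `tsum_cylinderOsc_le`). An edge just below level
`n` has `d_X`-length of order `e^{-εn}` and `μ`-mass of order `e^{-βn}`, and there are about `Kⁿ` of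
them. The identity `θpε = pε - (β - log K)` says that these factors balance: the weight `e^{θpεn}`
turns averages over `∂X` of `p`-th powers of increments along edges into energy on the tree.

Trace: along a ray, `f` varies below level `n` by at most the sum of the edge integrals of an upper
gradient `g`. Since `θ > 0`, a discrete Hardy inequality bounds the weighted `L^p` norms of these
tails by `∫ g^p dμ` (`tsum_lintegral_rayTail_le`). The tail from level 0 is therefore finite almost
everywhere, so limits exist, and it controls the `L^p` norm of the trace once `f` at the root is
controlled. Comparing two rays with their last common vertex bounds `oscₙ` by the tails from level
`n`, hence the Besov seminorm.

Extension: a vertex receives the average of `u` over its cylinder, and the function is affine on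
edges. The modulus of its slope is an upper gradient (`isUpperGradient_edgeSlope`), and consecutive
averages differ, in the mean of `p`-th powers, by at most a constant times the oscillations of the
two levels. Thus the energy is bounded by the discrete seminorm
(`lintegral_edgeSlope_cylinderAverage_le`). The `L^p(μ)` norm is bounded because `β > log K` gives
`μ` finite mass, and summability of `oscₙ` forces the averages to converge to `u` almost everywhere,
so that the trace is `u`. -/

noncomputable section

namespace KTree

/-! ### Parents and ancestors of vertices -/

section Vertices

variable {V : Type*} {G : SimpleGraph V} {o : V}

open Classical in
/-- The neighbour of `v` that is closer to the root (`v` itself if `v` is the root). -/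
def parent (G : SimpleGraph V) (o v : V) : V :=
  if h : ∃ w, G.Adj v w ∧ G.dist o v = G.dist o w + 1 then h.choose else v

/-- The vertex of level `n` on the geodesic from the root to `v`. -/
def above (G : SimpleGraph V) (o : V) (n : ℕ) (v : V) : V :=
  (parent G o)^[G.dist o v - n] v

theorem exists_adj_closer (hT : G.IsTree) {v : V} (hv : v ≠ o) :
    ∃ w, G.Adj v w ∧ G.dist o v = G.dist o w + 1 := by
  obtain ⟨p, hp⟩ := hT.connected.exists_walk_length_eq_dist v o
  cases p with
  | nil => exact absurd rfl hv
  | cons h q =>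
    rename_i w
    refine ⟨w, h, ?_⟩
    simp only [SimpleGraph.Walk.length_cons] at hp
    have h1 := SimpleGraph.dist_le q
    have h2 := h.diff_dist_adj (u := o)
    have h3 := G.dist_comm (u := v) (v := o)
    have h4 := G.dist_comm (u := w) (v := o)
    omega

theorem closer_unique (hT : G.IsTree) {v w₁ w₂ : V} (h₁ : G.Adj v w₁) (h₂ : G.Adj v w₂)
    (d₁ : G.dist o v = G.dist o w₁ + 1) (d₂ : G.dist o v = G.dist o w₂ + 1) : w₁ = w₂ := by
  obtain ⟨p₁, hp₁⟩ := hT.connected.exists_walk_length_eq_dist w₁ o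
  obtain ⟨p₂, hp₂⟩ := hT.connected.exists_walk_length_eq_dist w₂ o
  have e : ∀ x : V, G.dist x o = G.dist o x := fun x => G.dist_comm
  have q₁ : (SimpleGraph.Walk.cons h₁ p₁).IsPath :=
    SimpleGraph.Walk.isPath_of_length_eq_dist _ (by simp [hp₁, e, d₁])
  have q₂ : (SimpleGraph.Walk.cons h₂ p₂).IsPath :=
    SimpleGraph.Walk.isPath_of_length_eq_dist _ (by simp [hp₂, e, d₂])
  -- Both neighbours start a shortest walk to the root, hence a path; a tree has only one, so its
  -- second vertex is determined.
  have := (hT.isAcyclic.subsingleton_path v o).elim ⟨_, q₁⟩ ⟨_, q₂⟩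
  have h := congrArg (fun p : G.Path v o => p.1.snd) this
  simpa using h

theorem adj_parent (hT : G.IsTree) {v : V} (hv : v ≠ o) : G.Adj v (parent G o v) := by
  have h := exists_adj_closer hT hv
  rw [parent, dif_pos h]
  exact h.choose_spec.1

theorem dist_eq_dist_parent_add_one (hT : G.IsTree) {v : V} (hv : v ≠ o) :
    G.dist o v = G.dist o (parent G o v) + 1 := by
  have h := exists_adj_closer hT hv
  rw [parent, dif_pos h]
  exact h.choose_spec.2

theorem parent_root : parent G o o = o := by
  rw [parent, dif_neg]
  rintro ⟨w, -, h⟩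
  simp at h

theorem dist_parent (hT : G.IsTree) (v : V) : G.dist o (parent G o v) = G.dist o v - 1 := by
  by_cases hv : v = o
  · subst hv; simp [parent_root]
  · have := dist_eq_dist_parent_add_one hT hv
    omega

theorem ne_root_of_dist {v : V} {n : ℕ} (h : G.dist o v = n + 1) : v ≠ o := by
  rintro rfl
  simp at h

theorem parent_eq (hT : G.IsTree) {v w : V} (h : G.Adj v w) (d : G.dist o v = G.dist o w + 1) :
    parent G o v = w := by
  have hv : v ≠ o := ne_root_of_dist d
  exact closer_unique hT (adj_parent hT hv) h (dist_eq_dist_parent_add_one hT hv) d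

theorem mem_children_iff (hT : G.IsTree) {v w : V} :
    (G.Adj v w ∧ G.dist o w = G.dist o v + 1) ↔ (w ≠ o ∧ parent G o w = v) := by
  constructor
  · rintro ⟨h, d⟩
    exact ⟨ne_root_of_dist d, parent_eq hT h.symm d⟩
  · rintro ⟨h, rfl⟩
    exact ⟨(adj_parent hT h).symm, dist_eq_dist_parent_add_one hT h⟩

theorem dist_iterate_parent (hT : G.IsTree) (v : V) (k : ℕ) :
    G.dist o ((parent G o)^[k] v) = G.dist o v - k := by
  induction k with
  | zero => simp
  | succ k ih => rw [Function.iterate_succ_apply', dist_parent hT, ih]; omega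

theorem dist_above (hT : G.IsTree) {v : V} {n : ℕ} (h : n ≤ G.dist o v) :
    G.dist o (above G o n v) = n := by
  rw [above, dist_iterate_parent hT]; omega

@[simp] theorem above_self (v : V) : above G o (G.dist o v) v = v := by
  simp [above]

theorem above_above (hT : G.IsTree) {v : V} {m n : ℕ} (hmn : m ≤ n) (h : n ≤ G.dist o v) :
    above G o m (above G o n v) = above G o m v := by
  rw [above, dist_above hT h, above, above, ← Function.iterate_add_apply]
  congr 2; omega

theorem above_parent (hT : G.IsTree) {v : V} {n : ℕ} (h : n < G.dist o v) :
    above G o n (parent G o v) = above G o n v := by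
  rw [above, above, dist_parent hT, ← Function.iterate_succ_apply]
  congr 2; omega

theorem above_pred {v : V} : above G o (G.dist o v - 1) v = parent G o v := by
  by_cases hv : G.dist o v = 0
  · rw [above, hv]
    by_cases h : ∃ w, G.Adj v w ∧ G.dist o v = G.dist o w + 1
    · obtain ⟨w, -, h⟩ := h; omega
    · simp [parent, h]
  · rw [above, show G.dist o v - (G.dist o v - 1) = 1 by omega, Function.iterate_one]

theorem dist_iterate_parent_le (hT : G.IsTree) (v : V) (k : ℕ) :
    G.dist ((parent G o)^[k] v) v ≤ k := by
  induction k with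
  | zero => simp
  | succ k ih =>
    rw [Function.iterate_succ_apply']
    set w := (parent G o)^[k] v
    have h1 : G.dist (parent G o w) w ≤ 1 := by
      by_cases hw : w = o
      · rw [hw, parent_root]; simp
      · exact (SimpleGraph.dist_eq_one_iff_adj.2 (adj_parent hT hw).symm).le
    have := hT.connected.dist_triangle (u := parent G o w) (v := w) (w := v)
    omega

/-- This turns the metric definition of the ancestor relation into iteration of `parent`. If `a`
lies on the geodesic from the root to `b`, the first step of a shortest walk from `b` to `a` must go
to the parent of `b`, which allows induction on `G.dist a b`. -/
theorem dist_add_dist_eq_iff (hT : G.IsTree) {a b : V} :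
    G.dist o a + G.dist a b = G.dist o b ↔
      G.dist o a ≤ G.dist o b ∧ above G o (G.dist o a) b = a := by
  constructor
  · intro h
    refine ⟨by omega, ?_⟩
    induction hk : G.dist a b generalizing b with
    | zero =>
      rw [hT.connected.dist_eq_zero_iff] at hk
      subst hk
      simp
    | succ k ih =>
      obtain ⟨p, hp⟩ := hT.connected.exists_walk_length_eq_dist b a
      cases p with
      | nil => simp at hk
      | cons hadj q =>
        rename_i c
        simp only [SimpleGraph.Walk.length_cons] at hp
        have h1 := SimpleGraph.dist_le q
        have h3 := G.dist_comm (u := b) (v := a)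
        have h4 := G.dist_comm (u := c) (v := a)
        have h5 := hT.connected.dist_triangle (u := o) (v := a) (w := c)
        have h2 := hadj.diff_dist_adj (u := o)
        have h6 := hadj.diff_dist_adj (u := a)
        have hc : parent G o b = c := parent_eq hT hadj (by omega)
        have := ih (b := c) (by omega) (by omega)
        rw [← above_parent hT (v := b) (by omega), hc]
        exact this
  · rintro ⟨h, e⟩
    have h1 : G.dist a b ≤ G.dist o b - G.dist o a := by
      conv_lhs => rw [← e]
      exact dist_iterate_parent_le hT b _
    have h2 := hT.connected.dist_triangle (u := o) (v := a) (w := b)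
    omega

/-- The vertices `w` of level `n + m` below the vertex `v` of level `n`. -/
def descendants (G : SimpleGraph V) (o : V) (m : ℕ) (v : V) : Set V :=
  {w | G.dist o w = G.dist o v + m ∧ above G o (G.dist o v) w = v}

theorem descendants_zero (v : V) : descendants G o 0 v = {v} := by
  ext w
  simp only [descendants, add_zero, mem_ofPred_eq, mem_singleton_iff]
  constructor
  · rintro ⟨h, e⟩; rw [← h, above_self] at e; exact e
  · rintro rfl; simp

theorem mem_descendants_succ (hT : G.IsTree) {m : ℕ} {v w : V} :
    w ∈ descendants G o (m + 1) v ↔ w ≠ o ∧ parent G o w ∈ descendants G o m v := by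
  constructor
  · rintro ⟨h, e⟩
    refine ⟨ne_root_of_dist (n := G.dist o v + m) (by omega), ?_, ?_⟩
    · rw [dist_parent hT]; omega
    · rw [above_parent hT (by omega), e]
  · rintro ⟨h, h1, e⟩
    have := dist_eq_dist_parent_add_one hT h
    exact ⟨by omega, by rw [← above_parent hT (v := w) (by omega)]; exact e⟩

theorem IsKaryTree.isTree {K : ℕ} (hG : IsKaryTree G o K) : G.IsTree := hG.1

theorem IsKaryTree.encard_children {K : ℕ} (hG : IsKaryTree G o K) (v : V) :
    {w | w ≠ o ∧ parent G o w = v}.encard = K := by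
  rw [← hG.2 v]
  congr 1
  ext w
  exact (mem_children_iff hG.isTree).symm

theorem IsKaryTree.tsum_children {K : ℕ} (hG : IsKaryTree G o K) (v : V) (c : ℝ≥0∞) :
    ∑' _ : {w | w ≠ o ∧ parent G o w = v}, c = K * c := by
  have := hG.encard_children v
  rw [ENNReal.tsum_const, ← Set.encard, this]
  simp

theorem IsKaryTree.exists_child {K : ℕ} (hK : 2 ≤ K) (hG : IsKaryTree G o K) (v : V) :
    ∃ w, w ≠ o ∧ parent G o w = v := by
  have h := hG.encard_children v
  have : {w | w ≠ o ∧ parent G o w = v}.Nonempty := by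
    rw [← Set.encard_ne_zero, h]
    exact_mod_cast (by omega : K ≠ 0)
  exact this

theorem IsKaryTree.exists_dist_eq {K : ℕ} (hK : 2 ≤ K) (hG : IsKaryTree G o K) (n : ℕ) :
    ∃ v, G.dist o v = n := by
  induction n with
  | zero => exact ⟨o, by simp⟩
  | succ n ih =>
    obtain ⟨v, hv⟩ := ih
    obtain ⟨w, hw, e⟩ := hG.exists_child hK v
    exact ⟨w, by rw [dist_eq_dist_parent_add_one hG.isTree hw, e, hv]⟩

theorem IsKaryTree.tsum_descendants {K : ℕ} (hG : IsKaryTree G o K) (v : V) (m : ℕ) (c : ℝ≥0∞) :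
    ∑' _ : descendants G o m v, c = K ^ m * c := by
  induction m with
  | zero => rw [descendants_zero]; simp
  | succ m ih =>
    classical
    -- The vertices of the next generation are grouped by their parents; with indicators over `V`
    -- the two sums can be exchanged.
    have key : ∀ w : V, (descendants G o (m + 1) v).indicator (fun _ => c) w =
        ∑' x : V, (descendants G o m v).indicator
          (fun x => {w | w ≠ o ∧ parent G o w = x}.indicator (fun _ => c) w) x := by
      intro w
      rw [tsum_eq_single (parent G o w)]
      · simp only [indicator, mem_descendants_succ hG.isTree, mem_ofPred_eq, and_true]
        split_ifs <;> simp_all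
      · intro x hx
        simp only [indicator, mem_ofPred_eq]
        split_ifs <;> simp_all
    rw [tsum_subtype (descendants G o (m + 1) v) (fun _ => c), tsum_congr key, ENNReal.tsum_comm]
    have key2 : ∀ x : V, ∑' w : V, (descendants G o m v).indicator
        (fun x => {w | w ≠ o ∧ parent G o w = x}.indicator (fun _ => c) w) x =
        (descendants G o m v).indicator (fun _ => K * c) x := by
      intro x
      by_cases hx : x ∈ descendants G o m v
      · simp only [indicator_of_mem hx]
        rw [← hG.tsum_children x c, ← tsum_subtype]
      · simp [indicator_of_notMem hx]
    rw [tsum_congr key2, ← tsum_subtype, ENNReal.tsum_mul_left, ih, pow_succ]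
    ring

theorem IsKaryTree.countable {K : ℕ} (hG : IsKaryTree G o K) : Countable V := by
  have h : ∀ n : ℕ, {v | G.dist o v = n}.Countable := by
    intro n
    induction n with
    | zero =>
      refine (Set.countable_singleton o).mono fun v hv => ?_
      exact ((hG.isTree.connected.dist_eq_zero_iff).1 hv).symm
    | succ n ih =>
      refine (ih.biUnion (t := fun x _ => {w | w ≠ o ∧ parent G o w = x}) fun x _ => ?_).mono ?_
      · refine (Set.finite_of_encard_eq_coe (hG.encard_children x)).countable
      · intro v (hv : G.dist o v = n + 1)
        simp only [mem_iUnion]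
        refine ⟨parent G o v, ?_, ne_root_of_dist hv, rfl⟩
        simp [dist_parent hG.isTree, hv]
  rw [← Set.countable_univ_iff]
  refine (Set.countable_iUnion h).mono fun v _ => ?_
  simp

end Vertices

/-! ### Cylinders in the boundary -/

section Cylinders

variable {V : Type*} {G : SimpleGraph V} {o : V} {ε : ℝ}

/-- The geodesic rays that pass through the vertex `v`. -/
def cylinder (ε : ℝ) (v : V) : Set (Boundary G o ε) := {ζ | ζ.vertex (G.dist o v) = v}

theorem Boundary.parent_vertex (hT : G.IsTree) (ζ : Boundary G o ε) (n : ℕ) :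
    parent G o (ζ.vertex (n + 1)) = ζ.vertex n :=
  parent_eq hT (ζ.adj n).symm (by simp [ζ.dist_vertex])

theorem Boundary.vertex_eq_of_le (hT : G.IsTree) {ζ ξ : Boundary G o ε} {m n : ℕ} (hmn : m ≤ n)
    (h : ζ.vertex n = ξ.vertex n) : ζ.vertex m = ξ.vertex m := by
  induction n, hmn using Nat.le_induction with
  | base => exact h
  | succ n _ ih => exact ih (by rw [← ζ.parent_vertex hT, ← ξ.parent_vertex hT, h])

theorem Boundary.above_vertex (hT : G.IsTree) (ζ : Boundary G o ε) {m n : ℕ} (hmn : m ≤ n) :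
    above G o m (ζ.vertex n) = ζ.vertex m := by
  induction n, hmn using Nat.le_induction with
  | base => simp [above, ζ.dist_vertex m]
  | succ n hn ih => rw [← above_parent hT (by rw [ζ.dist_vertex]; omega), ζ.parent_vertex hT, ih]

theorem mem_cylinder_vertex_iff {ζ ξ : Boundary G o ε} {n : ℕ} :
    ξ ∈ cylinder ε (ζ.vertex n) ↔ ξ.vertex n = ζ.vertex n := by
  simp [cylinder, ζ.dist_vertex]

theorem Boundary.mem_cylinder_vertex (ζ : Boundary G o ε) (n : ℕ) :
    ζ ∈ cylinder ε (ζ.vertex n) := mem_cylinder_vertex_iff.2 rfl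

theorem cylinder_root : cylinder ε o = (univ : Set (Boundary G o ε)) := by
  ext ζ; simp [cylinder, ζ.vertex_zero]

theorem Boundary.le_level_iff (hT : G.IsTree) {ζ ξ : Boundary G o ε} (h : ζ ≠ ξ) {n : ℕ} :
    n ≤ ζ.level ξ ↔ ζ.vertex n = ξ.vertex n := by
  have hne : ζ.vertex ≠ ξ.vertex := fun h' => h (Boundary.ext h')
  have h1 := PiNat.apply_firstDiff_ne hne
  -- All rays start at the root, so the truncated subtraction in `level` loses nothing.
  have h0 : PiNat.firstDiff ζ.vertex ξ.vertex ≠ 0 := by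
    intro h0
    rw [h0, ζ.vertex_zero, ξ.vertex_zero] at h1
    exact h1 rfl
  rw [level]
  constructor
  · intro hn
    exact PiNat.apply_eq_of_lt_firstDiff (by omega)
  · intro hn
    by_contra hlt
    exact h1 (Boundary.vertex_eq_of_le hT (by omega) hn)

/-- A ray can be built by choosing children one after the other. -/
theorem exists_ray (hT : G.IsTree) (P : V → Prop) (h0 : P o)
    (h : ∀ v, P v → ∃ w, (w ≠ o ∧ parent G o w = v) ∧ P w) :
    ∃ ζ : Boundary G o ε, ∀ n, P (ζ.vertex n) := by
  choose! c hc hPc using h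
  have hP : ∀ n, P (c^[n] o) := by
    intro n
    induction n with
    | zero => exact h0
    | succ n ih => rw [Function.iterate_succ_apply']; exact hPc _ ih
  have hadj : ∀ n, G.Adj (c^[n] o) (c^[n + 1] o) ∧
      G.dist o (c^[n + 1] o) = G.dist o (c^[n] o) + 1 := by
    intro n
    rw [Function.iterate_succ_apply']
    exact (mem_children_iff hT).2 (hc _ (hP n))
  refine ⟨⟨fun n => c^[n] o, fun n => (hadj n).1, fun n => ?_, rfl⟩, hP⟩
  induction n with
  | zero => simp
  | succ n ih => rw [(hadj n).2, ih]

variable [hε : Fact (0 < ε)]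

theorem exp_neg_mul_le_iff {ε : ℝ} (hε : 0 < ε) {m n : ℕ} :
    2 / ε * Real.exp (-ε * m) ≤ 2 / ε * Real.exp (-ε * n) ↔ n ≤ m := by
  rw [mul_le_mul_iff_right₀ (by positivity), Real.exp_le_exp, neg_mul, neg_mul, neg_le_neg_iff,
    mul_le_mul_iff_right₀ hε, Nat.cast_le]

theorem Boundary.dist_le_of_vertex_eq (hT : G.IsTree) {ζ ξ : Boundary G o ε} {n : ℕ}
    (h : ζ.vertex n = ξ.vertex n) : dist ζ ξ ≤ 2 / ε * Real.exp (-ε * n) := by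
  have := hε.out
  by_cases hne : ζ = ξ
  · rw [hne, dist_self]; positivity
  · rw [dist_of_ne hne, exp_neg_mul_le_iff hε.out, Boundary.le_level_iff hT hne]
    exact h

/-- The boundary distance takes only the values `(2/ε)e^{-εk}` and zero, so an open ball does not
change while `t` runs over an interval open on the left and closed on the right. For `n = 0` there
is no upper limit on `t`, since the ball is already all of `∂X`. -/
theorem ball_eq_cylinder (hT : G.IsTree) (ζ : Boundary G o ε) {n : ℕ} {t : ℝ}
    (h1 : 2 / ε * Real.exp (-ε * n) < t)
    (h2 : n = 0 ∨ t ≤ 2 / ε * Real.exp (-ε * (n - 1 : ℝ))) :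
    Metric.ball ζ t = cylinder ε (ζ.vertex n) := by
  have := hε.out
  ext ξ
  rw [Metric.mem_ball, mem_cylinder_vertex_iff]
  constructor
  · intro h
    rcases h2 with rfl | h2
    · rw [ζ.vertex_zero, ξ.vertex_zero]
    · by_cases hne : ξ = ζ
      · rw [hne]
      · rw [← Boundary.le_level_iff hT hne]
        rw [Boundary.dist_of_ne hne] at h
        have h3 := h.trans_le h2
        rw [mul_lt_mul_iff_right₀ (by positivity), Real.exp_lt_exp, neg_mul, neg_mul, neg_lt_neg_iff,
          mul_lt_mul_iff_right₀ (by positivity)] at h3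
        have : (n : ℝ) < ξ.level ζ + 1 := by linarith
        have : n < ξ.level ζ + 1 := by exact_mod_cast this
        omega
  · intro h
    exact (Boundary.dist_le_of_vertex_eq hT h).trans_lt h1

theorem isOpen_cylinder (hT : G.IsTree) (v : V) : IsOpen (cylinder (G := G) (o := o) ε v) := by
  have := hε.out
  rw [Metric.isOpen_iff]
  intro ζ hζ
  have hv : v = ζ.vertex (G.dist o v) := hζ.symm
  refine ⟨2 / ε * Real.exp (-ε * ((G.dist o v : ℝ) - 1)), by positivity, ?_⟩
  rw [ball_eq_cylinder hT ζ (n := G.dist o v) ?_ (Or.inr le_rfl), ← hv]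
  gcongr 2 / ε * Real.exp ?_
  linarith

theorem measurableSet_cylinder (hT : G.IsTree) (v : V) :
    MeasurableSet (cylinder (G := G) (o := o) ε v) := (isOpen_cylinder hT v).measurableSet

theorem measurableSet_vertex_eq (hT : G.IsTree) (n : ℕ) (v : V) :
    MeasurableSet {ζ : Boundary G o ε | ζ.vertex n = v} := by
  by_cases h : G.dist o v = n
  · subst h; exact measurableSet_cylinder hT v
  · convert MeasurableSet.empty
    ext ζ
    simp only [mem_ofPred_eq, mem_empty_iff_false, iff_false]
    rintro rfl
    exact h (ζ.dist_vertex n)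

theorem measurable_comp_vertex [Countable V] (hT : G.IsTree) {β : Type*} [MeasurableSpace β]
    (h : V → β) (n : ℕ) : Measurable fun ζ : Boundary G o ε => h (ζ.vertex n) := by
  let _ : MeasurableSpace V := ⊤
  have : Measurable fun ζ : Boundary G o ε => ζ.vertex n :=
    measurable_to_countable' fun v => measurableSet_vertex_eq hT n v
  exact measurable_from_top.comp this

end Cylinders

/-! ### The Hausdorff measure of cylinders -/

section Hausdorff

variable {V : Type*} {G : SimpleGraph V} {o : V} {K : ℕ} {ε : ℝ}

/-- The dimension `log K / ε` is the exponent at which the scale of a cylinder is divided by exactly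
`K` from one level to the next. -/
theorem ofReal_rpow_log_div (hK : 2 ≤ K) (hε : 0 < ε) (n : ℕ) :
    ENNReal.ofReal (2 / ε * Real.exp (-ε * n)) ^ (Real.log K / ε) =
      ENNReal.ofReal (2 / ε) ^ (Real.log K / ε) * (K : ℝ≥0∞)⁻¹ ^ n := by
  have hK0 : (0 : ℝ) < K := by positivity
  have hs : 0 ≤ Real.log K / ε := div_nonneg (Real.log_natCast_nonneg K) hε.le
  rw [ENNReal.ofReal_mul (by positivity), ENNReal.mul_rpow_of_nonneg _ _ hs]
  congr 1
  rw [ENNReal.ofReal_rpow_of_pos (Real.exp_pos _), ← Real.exp_mul,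
    show -ε * n * (Real.log K / ε) = n * -Real.log K by field_simp, Real.exp_nat_mul,
    Real.exp_neg, Real.exp_log hK0, ENNReal.ofReal_pow (by positivity),
    ENNReal.ofReal_inv_of_pos hK0, ENNReal.ofReal_natCast]

theorem inv_natCast_lt_one (hK : 2 ≤ K) : (K : ℝ≥0∞)⁻¹ < 1 := by
  rw [ENNReal.inv_lt_one]
  exact_mod_cast (by omega : 1 < K)

theorem inv_natCast_pow_mono (hK : 2 ≤ K) {m n : ℕ} (h : m ≤ n) :
    (K : ℝ≥0∞)⁻¹ ^ n ≤ (K : ℝ≥0∞)⁻¹ ^ m :=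
  pow_le_pow_right_of_le_one' (inv_natCast_lt_one hK).le h

theorem natCast_mul_inv_pow_succ (hK : 2 ≤ K) (n : ℕ) :
    (K : ℝ≥0∞) * (K : ℝ≥0∞)⁻¹ ^ (n + 1) = (K : ℝ≥0∞)⁻¹ ^ n := by
  rw [pow_succ', ← mul_assoc, ENNReal.mul_inv_cancel, one_mul]
  · exact_mod_cast (by omega : K ≠ 0)
  · exact ENNReal.natCast_ne_top K

/-- If a cylinder is covered by cylinders, then the sum of their weights `K^{-n}` is at least that
of the cylinder. -/
theorem le_tsum_of_cylinder_subset (hK : 2 ≤ K) (hG : IsKaryTree G o K) (v : V) (w : ℕ → V)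
    (h : cylinder ε v ⊆ ⋃ i, (cylinder ε (w i) : Set (Boundary G o ε))) :
    (K : ℝ≥0∞)⁻¹ ^ G.dist o v ≤ ∑' i, (K : ℝ≥0∞)⁻¹ ^ G.dist o (w i) := by
  classical
  have hT := hG.isTree
  by_contra! hlt
  -- A covering cylinder of smaller level would by itself have enough weight.
  have hw : ∀ i, G.dist o v ≤ G.dist o (w i) := by
    intro i
    by_contra! hi
    exact absurd ((inv_natCast_pow_mono hK hi.le).trans (ENNReal.le_tsum i)) hlt.not_ge
  -- `M x` is the total weight of the covering cylinders attached to `x` or to vertices below `x`.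
  -- If the sum were too small, a ray could be followed along which `M` stays below `K⁻ⁿ`; this
  -- replaces a compactness argument.
  let M : V → ℝ≥0∞ := fun x => ∑' i, if G.dist o x ≤ G.dist o (w i) ∧
    above G o (G.dist o x) (w i) = x then (K : ℝ≥0∞)⁻¹ ^ G.dist o (w i) else 0
  have hMle : M v ≤ ∑' i, (K : ℝ≥0∞)⁻¹ ^ G.dist o (w i) :=
    ENNReal.tsum_le_tsum fun i => by split_ifs <;> simp
  -- If `x` is underweight, so is one of its `K` children, because the values of `M` at the children
  -- add up to at most `M x`.
  have hstep : ∀ x, M x < (K : ℝ≥0∞)⁻¹ ^ G.dist o x →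
      ∃ y, (y ≠ o ∧ parent G o y = x) ∧ M y < (K : ℝ≥0∞)⁻¹ ^ G.dist o y := by
    intro x hx
    by_contra! hcon
    refine absurd ?_ hx.not_ge
    calc (K : ℝ≥0∞)⁻¹ ^ G.dist o x
        = ∑' _ : {y | y ≠ o ∧ parent G o y = x}, (K : ℝ≥0∞)⁻¹ ^ (G.dist o x + 1) := by
          rw [hG.tsum_children, natCast_mul_inv_pow_succ hK]
      _ ≤ ∑' y : {y | y ≠ o ∧ parent G o y = x}, M y := by
          refine ENNReal.tsum_le_tsum fun y => ?_
          have h1 := hcon y y.2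
          rwa [dist_eq_dist_parent_add_one hT y.2.1, y.2.2] at h1
      _ ≤ M x := by
          rw [ENNReal.tsum_comm]
          refine ENNReal.tsum_le_tsum fun i => ?_
          rw [tsum_subtype {y | y ≠ o ∧ parent G o y = x} (fun y => if G.dist o y ≤ G.dist o (w i) ∧
            above G o (G.dist o y) (w i) = y then (K : ℝ≥0∞)⁻¹ ^ G.dist o (w i) else 0)]
          -- Each `w i` lies below at most one child of `x`.
          rw [tsum_eq_single (above G o (G.dist o x + 1) (w i))]
          · rw [indicator]
            split_ifs with h1 h2 h3 h4 <;> try simp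
            refine h3 ?_
            have hd := dist_eq_dist_parent_add_one hT h1.1
            rw [h1.2] at hd
            refine ⟨by omega, ?_⟩
            have := above_pred (G := G) (o := o) (v := above G o (G.dist o x + 1) (w i))
            rw [hd, h1.2, Nat.add_sub_cancel, above_above hT (by omega) (by omega)] at this
            exact this
          · intro y hy
            rw [indicator]
            split_ifs with h1 h2 <;> try rfl
            refine absurd ?_ hy
            rw [← h2.2, dist_eq_dist_parent_add_one hT h1.1, h1.2]
  -- The first clause forces the ray to pass through `v`, the second keeps it underweight from `v`
  -- on. Such a ray lies in some covering cylinder, whose vertex `w i` counts its own weight in `M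
  -- (w i)`: a contradiction.
  obtain ⟨ζ, hζ⟩ := exists_ray (ε := ε) (o := o) hT (fun x => (G.dist o x ≤ G.dist o v →
      x = above G o (G.dist o x) v) ∧
      (G.dist o v ≤ G.dist o x → M x < (K : ℝ≥0∞)⁻¹ ^ G.dist o x)) (by
    refine ⟨fun _ => ?_, fun hv => ?_⟩
    · refine (((hT.connected.dist_eq_zero_iff).1 ?_))
      rw [SimpleGraph.dist_self, dist_above hT (Nat.zero_le _)]
    · rw [SimpleGraph.dist_self, Nat.le_zero] at hv
      have : o = v := (hT.connected.dist_eq_zero_iff).1 hv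
      subst this
      exact hMle.trans_lt hlt) (by
    rintro x ⟨hx1, hx2⟩
    by_cases hx : G.dist o x < G.dist o v
    · have hd := dist_above (G := G) (o := o) hT (show G.dist o x + 1 ≤ G.dist o v from hx)
      refine ⟨above G o (G.dist o x + 1) v, ⟨ne_root_of_dist hd, ?_⟩, ?_, ?_⟩
      · rw [← above_pred, hd, above_above hT (by omega) (by omega), Nat.add_sub_cancel,
          ← hx1 hx.le]
      · intro _; rw [hd]
      · intro h'
        have : G.dist o x + 1 = G.dist o v := by omega
        rw [this, above_self]
        exact hMle.trans_lt hlt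
    · obtain ⟨y, hy, hMy⟩ := hstep x (hx2 (by omega))
      refine ⟨y, hy, fun h' => ?_, fun _ => hMy⟩
      have := dist_eq_dist_parent_add_one hT hy.1
      rw [hy.2] at this
      omega)
  have hζv : ζ ∈ cylinder ε v := by
    have := (hζ (G.dist o v)).1 (by rw [ζ.dist_vertex])
    rw [ζ.dist_vertex, above_self] at this
    exact this
  obtain ⟨i, hi⟩ := mem_iUnion.1 (h hζv)
  have hi' : ζ.vertex (G.dist o (w i)) = w i := hi
  have h1 := (hζ (G.dist o (w i))).2 (by rw [ζ.dist_vertex]; exact hw i)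
  rw [hi'] at h1
  refine absurd h1 (not_lt.2 ?_)
  refine le_trans ?_ (ENNReal.le_tsum i)
  simp

variable [hε : Fact (0 < ε)]

theorem ediam_cylinder_le (hT : G.IsTree) (v : V) :
    Metric.ediam (cylinder ε v : Set (Boundary G o ε)) ≤
      ENNReal.ofReal (2 / ε * Real.exp (-ε * G.dist o v)) := by
  refine Metric.ediam_le fun ζ hζ ξ hξ => ?_
  rw [edist_dist]
  exact ENNReal.ofReal_le_ofReal (Boundary.dist_le_of_vertex_eq hT (hζ.trans hξ.symm))

/-- The cylinder is covered by the `K^m` cylinders `m` levels further down. Their diameters tend to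
zero, while the bound for the sum of the powers of the diameters does not depend on `m`. -/
theorem hausdorffMeasure_cylinder_le (hK : 2 ≤ K) (hG : IsKaryTree G o K) (v : V) :
    Measure.hausdorffMeasure (Real.log K / ε) (cylinder ε v : Set (Boundary G o ε)) ≤
      ENNReal.ofReal (2 / ε) ^ (Real.log K / ε) * (K : ℝ≥0∞)⁻¹ ^ G.dist o v := by
  have hε0 := hε.out
  have hT := hG.isTree
  have := hG.countable
  have hs : 0 ≤ Real.log K / ε := div_nonneg (Real.log_natCast_nonneg K) hε0.le
  refine (Measure.hausdorffMeasure_le_liminf_tsum (l := atTop) (β := ℕ)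
    (ι := fun m => descendants G o m v) (Real.log K / ε) (cylinder ε v)
    (fun m => ENNReal.ofReal (2 / ε * Real.exp (-ε * (G.dist o v + m : ℕ)))) ?_
    (fun m w => cylinder ε w.1) (Eventually.of_forall fun m w => ?_)
    (Eventually.of_forall fun m ζ hζ => ?_)).trans ?_
  · rw [← ENNReal.ofReal_zero]
    refine ENNReal.tendsto_ofReal ?_
    rw [show (0 : ℝ) = 2 / ε * 0 by simp]
    refine Tendsto.const_mul _ (Real.tendsto_exp_atBot.comp ?_)
    refine Tendsto.const_mul_atTop_of_neg (by linarith) ?_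
    refine tendsto_natCast_atTop_atTop.comp ?_
    exact tendsto_atTop_mono (fun m => Nat.le_add_left m _) tendsto_id
  · have := ediam_cylinder_le (ε := ε) (o := o) hT w.1
    rwa [w.2.1] at this
  · have hζ' : ζ.vertex (G.dist o v) = v := hζ
    refine mem_iUnion.2 ⟨⟨ζ.vertex (G.dist o v + m), ζ.dist_vertex _, ?_⟩,
      ζ.mem_cylinder_vertex _⟩
    rw [ζ.above_vertex hT (by omega), hζ']
  · refine (liminf_le_liminf (v := fun _ => ENNReal.ofReal (2 / ε) ^ (Real.log K / ε) *
      (K : ℝ≥0∞)⁻¹ ^ G.dist o v) (Eventually.of_forall fun m => ?_)).trans (by simp)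
    calc ∑' w : descendants G o m v, Metric.ediam (cylinder ε w.1 : Set (Boundary G o ε)) ^
          (Real.log K / ε)
        ≤ ∑' _ : descendants G o m v, ENNReal.ofReal (2 / ε) ^ (Real.log K / ε) *
          (K : ℝ≥0∞)⁻¹ ^ (G.dist o v + m) := by
          refine ENNReal.tsum_le_tsum fun w => ?_
          rw [← ofReal_rpow_log_div hK hε0]
          refine ENNReal.rpow_le_rpow ?_ hs
          have := ediam_cylinder_le (ε := ε) (o := o) hT w.1
          rwa [w.2.1] at this
      _ = ENNReal.ofReal (2 / ε) ^ (Real.log K / ε) * (K : ℝ≥0∞)⁻¹ ^ G.dist o v := by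
          rw [hG.tsum_descendants, pow_add]
          have : (K : ℝ≥0∞) ^ m * (K : ℝ≥0∞)⁻¹ ^ m = 1 := by
            rw [← mul_pow, ENNReal.mul_inv_cancel, one_pow]
            · exact_mod_cast (by omega : K ≠ 0)
            · exact ENNReal.natCast_ne_top K
          calc _ = ENNReal.ofReal (2 / ε) ^ (Real.log K / ε) * (K : ℝ≥0∞)⁻¹ ^ G.dist o v *
                ((K : ℝ≥0∞) ^ m * (K : ℝ≥0∞)⁻¹ ^ m) := by ring
            _ = _ := by rw [this, mul_one]

theorem const_rpow_ne_top :
    ENNReal.ofReal (2 / ε) ^ (Real.log K / ε) ≠ ∞ := by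
  have hε0 := hε.out
  exact ENNReal.rpow_ne_top_of_nonneg (div_nonneg (Real.log_natCast_nonneg K) hε0.le)
    ENNReal.ofReal_ne_top

theorem const_rpow_ne_zero : ENNReal.ofReal (2 / ε) ^ (Real.log K / ε) ≠ 0 := by
  have hε0 := hε.out
  refine (ENNReal.rpow_pos ?_ ENNReal.ofReal_ne_top).ne'
  rw [ENNReal.ofReal_pos]
  positivity

/-- Every set lies in a cylinder of almost the same size. -/
theorem exists_subset_cylinder (hK : 2 ≤ K) (hG : IsKaryTree G o K) (t : Set (Boundary G o ε))
    {δ : ℝ≥0∞} (hδ : 0 < δ) :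
    ∃ w : V, t ⊆ cylinder ε w ∧
      ENNReal.ofReal (2 / ε) ^ (Real.log K / ε) * (K : ℝ≥0∞)⁻¹ ^ G.dist o w ≤
        (⨆ _ : t.Nonempty, Metric.ediam t ^ (Real.log K / ε)) + δ := by
  classical
  have hε0 := hε.out
  have hT := hG.isTree
  have hs : 0 ≤ Real.log K / ε := div_nonneg (Real.log_natCast_nonneg K) hε0.le
  by_cases hsub : t.Subsingleton
  -- A set with at most one point contributes nothing useful on the right, so the cylinder is taken
  -- so deep that its weight is below `δ`.
  · have hlim : Tendsto (fun n : ℕ => ENNReal.ofReal (2 / ε) ^ (Real.log K / ε) *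
        (K : ℝ≥0∞)⁻¹ ^ n) atTop (𝓝 (ENNReal.ofReal (2 / ε) ^ (Real.log K / ε) * 0)) :=
      ENNReal.Tendsto.const_mul
        (ENNReal.tendsto_pow_atTop_nhds_zero_of_lt_one (inv_natCast_lt_one hK))
        (Or.inr (const_rpow_ne_top))
    rw [mul_zero] at hlim
    obtain ⟨n, hn⟩ := (hlim.eventually (gt_mem_nhds hδ)).exists
    rcases hsub.eq_empty_or_singleton with rfl | ⟨ζ, rfl⟩
    · obtain ⟨w, hw⟩ := hG.exists_dist_eq hK n
      exact ⟨w, empty_subset _, by rw [hw]; exact hn.le.trans le_add_self⟩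
    · refine ⟨ζ.vertex n, singleton_subset_iff.2 (ζ.mem_cylinder_vertex n), ?_⟩
      rw [ζ.dist_vertex]
      exact hn.le.trans le_add_self
  · rw [Set.not_subsingleton_iff] at hsub
    obtain ⟨ζ, hζ, ξ, hξ, hne⟩ := hsub
    -- From a fixed point `ζ` of `t`, the least level at which some other point of `t` branches off
    -- gives the cylinder; that point `η` realizes the distance needed to bound the diameter of `t`
    -- from below.
    have hex : ∃ n, ∃ η ∈ t, ζ ≠ η ∧ ζ.level η = n := ⟨_, ξ, hξ, hne, rfl⟩
    obtain ⟨η, hη, hne', hlev⟩ := Nat.find_spec hex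
    refine ⟨ζ.vertex (Nat.find hex), fun x hx => ?_, ?_⟩
    · rw [mem_cylinder_vertex_iff]
      by_cases hxζ : ζ = x
      · exact congrArg (fun y : Boundary G o ε => y.vertex _) hxζ.symm
      · refine ((Boundary.le_level_iff hT hxζ).1 ?_).symm
        exact Nat.find_min' hex ⟨x, hx, hxζ, rfl⟩
    · refine le_trans ?_ le_self_add
      rw [iSup_pos ⟨ζ, hζ⟩, ζ.dist_vertex, ← ofReal_rpow_log_div hK hε0]
      refine ENNReal.rpow_le_rpow ?_ hs
      have := Metric.edist_le_ediam_of_mem hζ hη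
      rwa [edist_dist, Boundary.dist_of_ne hne', hlev] at this

theorem hausdorffMeasure_cylinder (hK : 2 ≤ K) (hG : IsKaryTree G o K) (v : V) :
    Measure.hausdorffMeasure (Real.log K / ε) (cylinder ε v : Set (Boundary G o ε)) =
      ENNReal.ofReal (2 / ε) ^ (Real.log K / ε) * (K : ℝ≥0∞)⁻¹ ^ G.dist o v := by
  refine (hausdorffMeasure_cylinder_le hK hG v).antisymm ?_
  rw [Measure.hausdorffMeasure_apply]
  -- The lower bound holds for all countable covers, however large their members, so any one scale
  -- suffices.
  refine le_trans ?_ (le_iSup₂ (1 : ℝ≥0∞) one_pos)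
  refine le_iInf₂ fun t ht => le_iInf fun _ => ?_
  refine ENNReal.le_of_forall_pos_le_add fun δ hδ _ => ?_
  obtain ⟨δ', hδ', hsum⟩ := ENNReal.exists_pos_sum_of_countable' (ε := (δ : ℝ≥0∞))
    (by exact_mod_cast hδ.ne') ℕ
  choose w hw hle using fun i => exists_subset_cylinder hK hG (t i) (hδ' i)
  calc ENNReal.ofReal (2 / ε) ^ (Real.log K / ε) * (K : ℝ≥0∞)⁻¹ ^ G.dist o v
      ≤ ENNReal.ofReal (2 / ε) ^ (Real.log K / ε) * ∑' i, (K : ℝ≥0∞)⁻¹ ^ G.dist o (w i) := by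
        gcongr
        exact le_tsum_of_cylinder_subset hK hG v w (ht.trans (iUnion_mono hw))
    _ = ∑' i, ENNReal.ofReal (2 / ε) ^ (Real.log K / ε) * (K : ℝ≥0∞)⁻¹ ^ G.dist o (w i) :=
        ENNReal.tsum_mul_left.symm
    _ ≤ ∑' i, ((⨆ _ : (t i).Nonempty, Metric.ediam (t i) ^ (Real.log K / ε)) + δ' i) :=
        ENNReal.tsum_le_tsum hle
    _ ≤ _ := by
        rw [ENNReal.tsum_add]
        gcongr

theorem boundaryMeasure_cylinder (hK : 2 ≤ K) (hG : IsKaryTree G o K) (v : V) :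
    boundaryMeasure G o K ε (cylinder ε v) = (K : ℝ≥0∞)⁻¹ ^ G.dist o v := by
  rw [boundaryMeasure, Measure.smul_apply, ← cylinder_root, hausdorffMeasure_cylinder hK hG,
    hausdorffMeasure_cylinder hK hG, SimpleGraph.dist_self, pow_zero, mul_one, smul_eq_mul,
    ← mul_assoc, ENNReal.inv_mul_cancel const_rpow_ne_zero (const_rpow_ne_top), one_mul]

theorem isProbabilityMeasure_boundaryMeasure (hK : 2 ≤ K) (hG : IsKaryTree G o K) :
    IsProbabilityMeasure (boundaryMeasure G o K ε) := by
  constructor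
  rw [← cylinder_root, boundaryMeasure_cylinder hK hG]
  simp

theorem lintegral_eq_tsum_cylinder (hG : IsKaryTree G o K) (n : ℕ) (h : Boundary G o ε → ℝ≥0∞)
    (ν : Measure (Boundary G o ε)) :
    ∫⁻ ζ, h ζ ∂ν = ∑' v : {v | G.dist o v = n}, ∫⁻ ζ in cylinder ε v.1, h ζ ∂ν := by
  have := hG.countable
  rw [← lintegral_iUnion, ← setLIntegral_univ]
  · congr 2
    ext ζ
    simp only [mem_univ, mem_iUnion, true_iff]
    exact ⟨⟨ζ.vertex n, ζ.dist_vertex n⟩, ζ.mem_cylinder_vertex n⟩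
  · exact fun v => measurableSet_cylinder hG.isTree _
  · rintro ⟨v, hv⟩ ⟨w, hw⟩ hne
    refine Set.disjoint_left.2 fun ζ hζ hζ' => hne (Subtype.ext ?_)
    simp only [mem_ofPred_eq] at hv hw
    simp only [cylinder, mem_ofPred_eq, hv, hw] at hζ hζ'
    exact hζ.symm.trans hζ'

theorem setLIntegral_cylinder_comp_vertex (hK : 2 ≤ K) (hG : IsKaryTree G o K) (v : V)
    (h : V → ℝ≥0∞) :
    ∫⁻ ζ in cylinder ε v, h (ζ.vertex (G.dist o v)) ∂boundaryMeasure G o K ε =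
      (K : ℝ≥0∞)⁻¹ ^ G.dist o v * h v := by
  rw [setLIntegral_congr_fun (g := fun _ => h v) (measurableSet_cylinder hG.isTree v)
    (fun ζ (hζ : _ = v) => by rw [hζ]), setLIntegral_const, boundaryMeasure_cylinder hK hG,
    mul_comm]

theorem lintegral_comp_vertex (hK : 2 ≤ K) (hG : IsKaryTree G o K) (n : ℕ) (h : V → ℝ≥0∞) :
    ∫⁻ ζ : Boundary G o ε, h (ζ.vertex n) ∂boundaryMeasure G o K ε =
      ∑' v : {v | G.dist o v = n}, (K : ℝ≥0∞)⁻¹ ^ n * h v := by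
  rw [lintegral_eq_tsum_cylinder hG n]
  refine tsum_congr ?_
  rintro ⟨v, rfl⟩
  exact setLIntegral_cylinder_comp_vertex hK hG v h

/-- Averaging over the cylinders of level `n` does not change the integral. -/
theorem lintegral_laverage_cylinder (hK : 2 ≤ K) (hG : IsKaryTree G o K) (n : ℕ)
    (h : Boundary G o ε → ℝ≥0∞) :
    ∫⁻ ζ, (⨍⁻ ξ in cylinder ε (ζ.vertex n), h ξ ∂boundaryMeasure G o K ε)
      ∂boundaryMeasure G o K ε = ∫⁻ ζ, h ζ ∂boundaryMeasure G o K ε := by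
  rw [lintegral_comp_vertex hK hG n
    (fun v => ⨍⁻ ξ in cylinder ε v, h ξ ∂boundaryMeasure G o K ε), lintegral_eq_tsum_cylinder hG n]
  refine tsum_congr fun v => ?_
  have hv : G.dist o v.1 = n := v.2
  rw [setLAverage_eq, boundaryMeasure_cylinder hK hG, hv, ENNReal.mul_div_cancel]
  · simp
  · exact ENNReal.pow_ne_top (ENNReal.inv_ne_top.2 (by exact_mod_cast (by omega : K ≠ 0)))

end Hausdorff
/-! ### Inequalities of Jensen and Hardy -/

section Inequalities

/-- Hölder's inequality against the constant function 1. -/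
theorem lintegral_rpow_le {Ω : Type*} [MeasurableSpace Ω] (μ : Measure Ω) {p : ℝ} (hp : 1 ≤ p)
    {f : Ω → ℝ≥0∞} (hf : AEMeasurable f μ) :
    (∫⁻ x, f x ∂μ) ^ p ≤ μ univ ^ (p - 1) * ∫⁻ x, f x ^ p ∂μ := by
  rcases hp.eq_or_lt with rfl | hp
  · simp
  have hpq := Real.HolderConjugate.conjExponent hp
  have h := ENNReal.lintegral_mul_le_Lp_mul_Lq μ hpq hf (g := fun _ => 1) aemeasurable_const
  simp only [Pi.mul_apply, mul_one, ENNReal.one_rpow, lintegral_const, one_mul] at h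
  have h2 := ENNReal.rpow_le_rpow h (zero_le_one.trans hp.le)
  refine h2.trans (le_of_eq ?_)
  rw [ENNReal.mul_rpow_of_nonneg _ _ (by linarith), ← ENNReal.rpow_mul, ← ENNReal.rpow_mul,
    mul_comm]
  have h0 : p ≠ 0 := by linarith
  congr 1
  · congr 1
    rw [Real.conjExponent]
    have : p - 1 ≠ 0 := by linarith
    field_simp
  · rw [one_div, inv_mul_cancel₀ h0]
    simp

theorem lintegral_rpow_le_of_isProbabilityMeasure {Ω : Type*} [MeasurableSpace Ω] (μ : Measure Ω)
    [IsProbabilityMeasure μ] {p : ℝ} (hp : 1 ≤ p) {f : Ω → ℝ≥0∞} (hf : AEMeasurable f μ) :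
    (∫⁻ x, f x ∂μ) ^ p ≤ ∫⁻ x, f x ^ p ∂μ := by
  simpa using lintegral_rpow_le μ hp hf

theorem tsum_mul_rpow_le {p : ℝ} (hp : 1 ≤ p) (w f : ℕ → ℝ≥0∞) :
    (∑' j, w j * f j) ^ p ≤ (∑' j, w j) ^ (p - 1) * ∑' j, w j * f j ^ p := by
  have h := lintegral_rpow_le (Measure.sum fun j : ℕ => w j • Measure.dirac j) hp (f := f)
    measurable_from_top.aemeasurable
  simpa [lintegral_sum_measure, Measure.sum_apply] using h

/-- A discrete Hardy inequality for the tails of a series of functions. -/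
theorem tsum_lintegral_tail_le {Ω : Type*} [MeasurableSpace Ω] (μ : Measure Ω) {p : ℝ} (hp : 1 ≤ p)
    {r : ℝ≥0∞} (hr0 : r ≠ 0) (hr1 : r ≠ ∞) (b : ℕ → Ω → ℝ≥0∞) (hb : ∀ n, Measurable (b n))
    (M : ℕ → ℝ≥0∞) (hM : ∀ n, (r⁻¹ ^ p) ^ n * ∫⁻ x, b n x ^ p ∂μ ≤ M n) :
    ∑' n, (r⁻¹ ^ p) ^ n * ∫⁻ x, (∑' j, b (n + j) x) ^ p ∂μ ≤
      (∑' j, r ^ j) ^ (p - 1) * (∑' j, r ^ j) * ∑' n, M n := by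
  have hp0 : 0 ≤ p := zero_le_one.trans hp
  -- Hölder's inequality with weights `r^j`, after writing each term as `r^j` times `r⁻ʲ b`. The
  -- factor `r^{-jp}` this produces completes the weight `r^{-np}` to the one of level `n + j`, and
  -- the spare `r^j` is what remains to be summed over the shifts.
  have hpt : ∀ n x, (∑' j, b (n + j) x) ^ p ≤
      (∑' j, r ^ j) ^ (p - 1) * ∑' j, r ^ j * ((r⁻¹ ^ p) ^ j * b (n + j) x ^ p) := by
    intro n x
    have h := tsum_mul_rpow_le hp (fun j => r ^ j) (fun j => r⁻¹ ^ j * b (n + j) x)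
    have e1 : ∀ j, r ^ j * (r⁻¹ ^ j * b (n + j) x) = b (n + j) x := by
      intro j
      rw [← mul_assoc, ← mul_pow, ENNReal.mul_inv_cancel hr0 hr1, one_pow, one_mul]
    have e2 : ∀ j, (r⁻¹ ^ j * b (n + j) x) ^ p = (r⁻¹ ^ p) ^ j * b (n + j) x ^ p := by
      intro j
      rw [ENNReal.mul_rpow_of_nonneg _ _ hp0, ← ENNReal.rpow_natCast, ← ENNReal.rpow_natCast,
        ← ENNReal.rpow_mul, ← ENNReal.rpow_mul, mul_comm (j : ℝ) p]
    simpa only [e1, e2] using h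
  have hn : ∀ n, (r⁻¹ ^ p) ^ n * ∫⁻ x, (∑' j, b (n + j) x) ^ p ∂μ ≤
      (∑' j, r ^ j) ^ (p - 1) * ∑' j, r ^ j * M (n + j) := by
    intro n
    have hmeas : ∀ j, Measurable fun x => b (n + j) x ^ p := fun j => (hb (n + j)).pow_const p
    calc (r⁻¹ ^ p) ^ n * ∫⁻ x, (∑' j, b (n + j) x) ^ p ∂μ
        ≤ (r⁻¹ ^ p) ^ n * ∫⁻ x, (∑' j, r ^ j) ^ (p - 1) *
            ∑' j, r ^ j * ((r⁻¹ ^ p) ^ j * b (n + j) x ^ p) ∂μ := by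
          gcongr with x
          exact hpt n x
      _ = (∑' j, r ^ j) ^ (p - 1) * ∑' j, r ^ j *
            ((r⁻¹ ^ p) ^ (n + j) * ∫⁻ x, b (n + j) x ^ p ∂μ) := by
          rw [lintegral_const_mul _ (by fun_prop), lintegral_tsum (by fun_prop), mul_left_comm,
            ← ENNReal.tsum_mul_left]
          congr 1
          refine tsum_congr fun j => ?_
          rw [lintegral_const_mul _ (by fun_prop), lintegral_const_mul _ (by fun_prop), pow_add]
          ring
      _ ≤ _ := by
          gcongr with j
          exact hM (n + j)
  calc ∑' n, (r⁻¹ ^ p) ^ n * ∫⁻ x, (∑' j, b (n + j) x) ^ p ∂μ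
      ≤ ∑' n, (∑' j, r ^ j) ^ (p - 1) * ∑' j, r ^ j * M (n + j) := ENNReal.tsum_le_tsum hn
    _ = (∑' j, r ^ j) ^ (p - 1) * ∑' j, r ^ j * ∑' n, M (n + j) := by
        rw [ENNReal.tsum_mul_left, ENNReal.tsum_comm]
        simp_rw [ENNReal.tsum_mul_left]
    _ ≤ (∑' j, r ^ j) ^ (p - 1) * ∑' j, r ^ j * ∑' n, M n := by
        exact mul_le_mul' le_rfl (ENNReal.tsum_le_tsum fun j => mul_le_mul' le_rfl
          (ENNReal.tsum_comp_le_tsum_of_injective (add_left_injective j) M))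
    _ = _ := by rw [ENNReal.tsum_mul_right, mul_assoc]

theorem add_rpow_le {p : ℝ} (hp : 1 ≤ p) (a b : ℝ≥0∞) :
    (a + b) ^ p ≤ 2 ^ (p - 1) * (a ^ p + b ^ p) := ENNReal.rpow_add_le_mul_rpow_add_rpow a b hp

end Inequalities

/-! ### Points and integrals on the tree -/

section Points

variable {V : Type*} {G : SimpleGraph V} {o : V}

theorem Point.dist_le_of_height_le {x y : Point G o} (h : x.height ≤ y.height) :
    G.dist o x.vert ≤ G.dist o y.vert := by
  rw [← x.ceil_height, ← y.ceil_height]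
  exact Nat.ceil_mono h

theorem Point.height_le (x : Point G o) : x.height ≤ G.dist o x.vert := by
  rw [← x.ceil_height]
  exact Nat.le_ceil _

theorem Point.lt_height {x : Point G o} (h : x.vert ≠ o) (hT : G.IsTree) :
    (G.dist o x.vert : ℝ) - 1 < x.height := by
  rw [← x.ceil_height]
  have h1 : ⌈x.height⌉₊ ≠ 0 := by
    rw [x.ceil_height]
    intro h0
    exact h (hT.connected.dist_eq_zero_iff.1 h0).symm
  have := Nat.ceil_lt_add_one x.height_nonneg
  linarith

theorem Point.anc_iff (hT : G.IsTree) {x y : Point G o} :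
    x.Anc y ↔ x.height ≤ y.height ∧ above G o (G.dist o x.vert) y.vert = x.vert := by
  rw [Point.Anc, dist_add_dist_eq_iff hT]
  constructor
  · rintro ⟨h, -, h'⟩; exact ⟨h, h'⟩
  · rintro ⟨h, h'⟩; exact ⟨h, Point.dist_le_of_height_le h, h'⟩

theorem Point.Anc.trans (hT : G.IsTree) {x y z : Point G o} (h : x.Anc y) (h' : y.Anc z) :
    x.Anc z := by
  rw [Point.anc_iff hT] at *
  refine ⟨h.1.trans h'.1, ?_⟩
  have h2 := Point.dist_le_of_height_le h'.1
  have := above_above hT (Point.dist_le_of_height_le h.1) h2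
  rw [h'.2, h.2] at this
  exact this.symm

theorem Point.Anc.of_height_le (hT : G.IsTree) {x y z : Point G o} (h : x.Anc z) (h' : y.Anc z)
    (hxy : x.height ≤ y.height) : x.Anc y := by
  rw [Point.anc_iff hT] at *
  refine ⟨hxy, ?_⟩
  have := above_above hT (Point.dist_le_of_height_le hxy) (Point.dist_le_of_height_le h'.1)
  rwa [h'.2, h.2] at this

/-- The points on the geodesic from the root to `x`. -/
def segment (x : Point G o) : Set (Point G o) := {z | z.Anc x}

/-- This inclusion is all that is needed to bound line integrals from below. A common ancestor `w`
of `x` and `y` is comparable with a point `z` of `[0, x]`; if `z` were above `w`, it would also be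
an ancestor of `y`. -/
theorem segment_diff_subset_geodesic (hT : G.IsTree) (x y : Point G o) :
    (segment x \ segment y) ∪ (segment y \ segment x) ⊆ geodesic x y := by
  rintro z (⟨hx, hy⟩ | ⟨hy, hx⟩)
  · refine ⟨Or.inl hx, fun w hwx hwy => ?_⟩
    rcases le_total w.height z.height with h | h
    · exact hwx.of_height_le hT hx h
    · exact absurd ((Point.Anc.of_height_le hT hx hwx h).trans hT hwy) hy
  · refine ⟨Or.inr hy, fun w hwx hwy => ?_⟩
    rcases le_total w.height z.height with h | h
    · exact hwy.of_height_le hT hy h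
    · exact absurd ((Point.Anc.of_height_le hT hy hwy h).trans hT hwx) hx

theorem Point.measurable_height : Measurable (Point.height : Point G o → ℝ) := by
  let _ : MeasurableSpace V := ⊤
  exact measurable_snd.comp (comap_measurable (fun x : Point G o => (x.vert, x.height)))

theorem Point.measurable_comp_vert {β : Type*} [MeasurableSpace β] (h : V → β) :
    Measurable fun x : Point G o => h x.vert := by
  let _ : MeasurableSpace V := ⊤
  exact (measurable_from_top (f := h)).comp
    (measurable_fst.comp (comap_measurable (fun x : Point G o => (x.vert, x.height))))

theorem Point.measurableSet_vert (s : Set V) : MeasurableSet {x : Point G o | x.vert ∈ s} :=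
  measurableSet_setOfPred.2 (Point.measurable_comp_vert fun v => v ∈ s)

theorem measurableSet_segment (x : Point G o) : MeasurableSet (segment x) :=
  (measurableSet_le Point.measurable_height measurable_const).inter
    (Point.measurableSet_vert
      {v | G.dist o v + G.dist v x.vert = G.dist o x.vert})

theorem edgePoint_spec (hT : G.IsTree) {v : V} (hv : v ≠ o) {t : ℝ}
    (ht : t ∈ Ioc ((G.dist o v : ℝ) - 1) (G.dist o v)) :
    (edgePoint G o v t).vert = v ∧ (edgePoint G o v t).height = t := by
  have h1 : 1 ≤ G.dist o v := by
    rw [dist_eq_dist_parent_add_one hT hv]; omega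
  have h1' : (1 : ℝ) ≤ G.dist o v := by exact_mod_cast h1
  have h : 0 ≤ t ∧ ⌈t⌉₊ = G.dist o v := by
    refine ⟨by linarith [ht.1], (Nat.ceil_eq_iff (by omega)).2 ⟨?_, ht.2⟩⟩
    rw [Nat.cast_sub h1, Nat.cast_one]
    exact ht.1
  simp [edgePoint, h]

theorem measurable_edgePoint (v : V) : Measurable (edgePoint G o v) := by
  classical
  let _ : MeasurableSpace V := ⊤
  have hS : MeasurableSet {t : ℝ | 0 ≤ t ∧ ⌈t⌉₊ = G.dist o v} :=
    measurableSet_Ici.inter (Nat.measurable_ceil (measurableSet_singleton _))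
  rw [measurable_comap_iff]
  have : (fun x : Point G o => (x.vert, x.height)) ∘ edgePoint G o v =
      fun t => if 0 ≤ t ∧ ⌈t⌉₊ = G.dist o v then (v, t) else (o, 0) := by
    ext1 t
    by_cases h : 0 ≤ t ∧ ⌈t⌉₊ = G.dist o v <;> simp [edgePoint, h, Point.root]
  rw [this]
  exact Measurable.ite hS (measurable_const.prodMk measurable_id) measurable_const

theorem lintegral_lengthMeasure {F : Point G o → ℝ≥0∞} (hF : Measurable F) :
    ∫⁻ z, F z ∂lengthMeasure G o = ∑' v : {v : V // v ≠ o},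
      ∫⁻ t in Ioc ((G.dist o v : ℝ) - 1) (G.dist o v), F (edgePoint G o v t) := by
  rw [lengthMeasure, lintegral_sum_measure]
  exact tsum_congr fun v => lintegral_map hF (measurable_edgePoint v.1)

theorem lintegral_treeMeasure (β : ℝ) {F : Point G o → ℝ≥0∞} (hF : Measurable F) :
    ∫⁻ z, F z ∂treeMeasure G o β = ∫⁻ z, F z * ENNReal.ofReal (Real.exp (-β * z.height))
      ∂lengthMeasure G o := by
  have hh := Point.measurable_height (G := G) (o := o)
  rw [treeMeasure, lintegral_withDensity_eq_lintegral_mul _ (by fun_prop) hF]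
  simp [mul_comm]

theorem setLIntegral_edge (hT : G.IsTree) {v : V} (hv : v ≠ o) {F : Point G o → ℝ≥0∞}
    (hF : Measurable F) :
    ∫⁻ z in {z | z.vert = v}, F z ∂lengthMeasure G o =
      ∫⁻ t in Ioc ((G.dist o v : ℝ) - 1) (G.dist o v), F (edgePoint G o v t) := by
  have hS : MeasurableSet {z : Point G o | z.vert = v} := Point.measurableSet_vert {v}
  rw [← lintegral_indicator hS, lintegral_lengthMeasure (hF.indicator hS),
    tsum_eq_single ⟨v, hv⟩]
  · refine setLIntegral_congr_fun measurableSet_Ioc fun t ht => ?_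
    simp [indicator, (edgePoint_spec hT hv ht).1]
  · rintro ⟨w, hw⟩ hne
    have : w ≠ v := fun h => hne (Subtype.ext h)
    rw [setLIntegral_congr_fun (g := fun _ => 0) measurableSet_Ioc fun t ht => ?_, lintegral_zero]
    simp [indicator, (edgePoint_spec hT hw ht).1, this]

theorem lengthMeasure_height_eq (hT : G.IsTree) (h : ℝ) :
    lengthMeasure G o {z | z.height = h} = 0 := by
  have hS : MeasurableSet {z : Point G o | z.height = h} :=
    Point.measurable_height (measurableSet_singleton h)
  rw [← lintegral_indicator_one hS, lintegral_lengthMeasure (measurable_one.indicator hS),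
    ENNReal.tsum_eq_zero]
  rintro ⟨v, hv⟩
  refine (setLIntegral_congr_fun (g := ({h} : Set ℝ).indicator 1) measurableSet_Ioc
    fun t ht => ?_).trans ?_
  · simp [indicator, (edgePoint_spec hT hv ht).2]
  · rw [lintegral_indicator_one (measurableSet_singleton h)]
    simp

/-- The integral of `g` over the edge that ends in `v`, with respect to `d_X`. -/
def edgeIntegral (ε : ℝ) (g : Point G o → ℝ≥0∞) (v : V) : ℝ≥0∞ :=
  ∫⁻ t in Ioc ((G.dist o v : ℝ) - 1) (G.dist o v),
    g (edgePoint G o v t) * ENNReal.ofReal (Real.exp (-ε * t))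

/-- A vertex, as a point of the metric tree. -/
def vertexPoint (G : SimpleGraph V) (o v : V) : Point G o :=
  ⟨v, G.dist o v, Nat.cast_nonneg _, Nat.ceil_natCast _⟩

theorem setLIntegral_edge_mul_exp (hT : G.IsTree) {v : V} (hv : v ≠ o) (a : ℝ)
    {F : Point G o → ℝ≥0∞} (hF : Measurable F) :
    ∫⁻ z in {z | z.vert = v}, F z * ENNReal.ofReal (Real.exp (-a * z.height)) ∂lengthMeasure G o =
      edgeIntegral a F v := by
  have hh := Point.measurable_height (G := G) (o := o)
  rw [setLIntegral_edge hT hv (by fun_prop), edgeIntegral]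
  refine setLIntegral_congr_fun measurableSet_Ioc fun t ht => ?_
  simp only [(edgePoint_spec hT hv ht).2]

/-- The exponent of `edgeIntegral` is a free parameter: with `ε` it measures `d_X`-length along an
edge, with `β` it gives the `μ`-integral over it. -/
theorem lintegral_treeMeasure_eq_tsum (hT : G.IsTree) (β : ℝ) {F : Point G o → ℝ≥0∞}
    (hF : Measurable F) :
    ∫⁻ z, F z ∂treeMeasure G o β = ∑' v : {v : V // v ≠ o}, edgeIntegral β F v.1 := by
  have hh := Point.measurable_height (G := G) (o := o)
  rw [lintegral_treeMeasure β hF, lintegral_lengthMeasure (by fun_prop)]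
  refine tsum_congr fun v => setLIntegral_congr_fun measurableSet_Ioc fun t ht => ?_
  simp only [(edgePoint_spec hT v.2 ht).2]

/-- Apart from points at the height of the parent, which form a null set, the geodesic stays on the
edge that contains `y`. The bound uses the whole edge, so it is uniform in `y` on that edge. -/
theorem lineIntegral_le_edgeIntegral (hT : G.IsTree) (ε : ℝ) {g : Point G o → ℝ≥0∞}
    (hg : Measurable g) (y : Point G o) (hy : y.vert ≠ o) :
    lineIntegral ε g (vertexPoint G o (parent G o y.vert)) y ≤ edgeIntegral ε g y.vert := by
  set x := vertexPoint G o (parent G o y.vert) with hx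
  have hd := dist_eq_dist_parent_add_one hT hy
  have hd' : (G.dist o y.vert : ℝ) = x.height + 1 := by
    rw [hd]; simp [hx, vertexPoint]
  have hxy : x.Anc y := by
    rw [Point.anc_iff hT]
    refine ⟨by linarith [Point.lt_height hy hT], ?_⟩
    have := above_pred (G := G) (o := o) (v := y.vert)
    rw [hd, Nat.add_sub_cancel] at this
    exact this
  have hxx : x.Anc x := by
    rw [Point.anc_iff hT]
    exact ⟨le_rfl, above_self _⟩
  have hsub : geodesic x y ⊆ {z | z.height = x.height} ∪ {z | z.vert = y.vert} := by
    rintro z ⟨hz, hz'⟩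
    have hxz := hz' x hxx hxy
    have hzy : z.Anc y := hz.elim (fun h => h.trans hT hxy) id
    rcases hxz.1.eq_or_lt with h | h
    · exact Or.inl h.symm
    · right
      rw [Point.anc_iff hT] at hzy
      have h1 : G.dist o z.vert = G.dist o y.vert := by
        refine le_antisymm (Point.dist_le_of_height_le hzy.1) ?_
        have h2 : (G.dist o (parent G o y.vert) : ℝ) < G.dist o z.vert := h.trans_le z.height_le
        have h3 : G.dist o (parent G o y.vert) < G.dist o z.vert := by exact_mod_cast h2
        omega
      have h2 := hzy.2
      rw [h1, above_self] at h2
      exact h2.symm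
  rw [lineIntegral, ← setLIntegral_edge_mul_exp hT hy ε hg]
  refine (lintegral_mono_set hsub).trans ((lintegral_union_le _ _ _).trans ?_)
  rw [setLIntegral_measure_zero _ _ (lengthMeasure_height_eq hT _), zero_add]

theorem IsUpperGradient.edist_le (hT : G.IsTree) {ε : ℝ} {f : Point G o → ℝ}
    {g : Point G o → ℝ≥0∞} (hg : IsUpperGradient ε f g) (y : Point G o) (hy : y.vert ≠ o) :
    edist (f (vertexPoint G o (parent G o y.vert))) (f y) ≤ edgeIntegral ε g y.vert := by
  rw [edist_dist, Real.dist_eq]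
  exact (hg.2 _ y).trans (lineIntegral_le_edgeIntegral hT ε hg.1 y hy)

end Points

/-! ### A discrete form of the Besov seminorm -/

section Besov

variable {V : Type*} {G : SimpleGraph V} {o : V} {K : ℕ} {ε : ℝ}

/-- The mean oscillation of `u` over the cylinders of level `n`. -/
def cylinderOsc [Fact (0 < ε)] (K : ℕ) (p : ℝ) (u : Boundary G o ε → ℝ) (n : ℕ) : ℝ≥0∞ :=
  ∫⁻ ζ, (⨍⁻ ξ in cylinder ε (ζ.vertex n), ENNReal.ofReal |u ζ - u ξ| ^ p ∂boundaryMeasure G o K ε)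
    ∂boundaryMeasure G o K ε

theorem rpow_neg_two_div_mul_exp (hε : 0 < ε) (a x : ℝ) :
    (2 / ε * Real.exp (-ε * x)) ^ (-a) = (2 / ε) ^ (-a) * Real.exp (a * ε * x) := by
  rw [Real.mul_rpow (by positivity) (by positivity), ← Real.exp_mul]
  congr 2
  ring

variable [hε : Fact (0 < ε)]

/-- Balls with such radii are cylinders of level `n`, so `besovE` is constant there and only a power
of `t` remains to be integrated. -/
theorem besov_integrand_eq (hT : G.IsTree) {θ p : ℝ} (hp : 1 ≤ p) (u : Boundary G o ε → ℝ) {n : ℕ}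
    {t : ℝ} (h1 : 2 / ε * Real.exp (-ε * n) < t)
    (h2 : n = 0 ∨ t ≤ 2 / ε * Real.exp (-ε * (n - 1 : ℝ))) :
    (besovE K p u t / ENNReal.ofReal (t ^ θ)) ^ p / ENNReal.ofReal t =
      cylinderOsc K p u n * ENNReal.ofReal (t ^ (-(θ * p) - 1)) := by
  have hε0 := hε.out
  have ht : 0 < t := lt_of_le_of_lt (by positivity) h1
  have hp0 : 0 < p := by linarith
  have hE : besovE K p u t = cylinderOsc K p u n ^ (1 / p) := by
    rw [besovE, cylinderOsc]
    simp_rw [ball_eq_cylinder hT _ h1 h2]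
  have htθ : 0 < t ^ θ := Real.rpow_pos_of_pos ht θ
  rw [hE, ENNReal.div_rpow_of_nonneg _ _ hp0.le, ← ENNReal.rpow_mul, one_div,
    inv_mul_cancel₀ hp0.ne', ENNReal.rpow_one, ENNReal.ofReal_rpow_of_pos htθ, ← Real.rpow_mul ht.le,
    div_eq_mul_inv, div_eq_mul_inv, mul_assoc, ← ENNReal.ofReal_inv_of_pos ht,
    ← ENNReal.ofReal_inv_of_pos (Real.rpow_pos_of_pos ht _), ← ENNReal.ofReal_mul (by positivity),
    Real.rpow_sub_one ht.ne', Real.rpow_neg ht.le, div_eq_mul_inv]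

theorem besovSeminorm_rpow (θ : ℝ) {p : ℝ} (hp : 1 ≤ p) (u : Boundary G o ε → ℝ) :
    besovSeminorm K θ p p u ^ p =
      ∫⁻ t in Ioi (0 : ℝ), (besovE K p u t / ENNReal.ofReal (t ^ θ)) ^ p / ENNReal.ofReal t := by
  rw [besovSeminorm, ← ENNReal.rpow_mul, one_div, inv_mul_cancel₀ (by linarith), ENNReal.rpow_one]

theorem lintegral_Ioi_rpow {a c : ℝ} (ha : 0 < a) (hc : 0 < c) :
    ∫⁻ t in Ioi c, ENNReal.ofReal (t ^ (-a - 1)) = ENNReal.ofReal (c ^ (-a) / a) := by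
  rw [← ofReal_integral_eq_lintegral_ofReal (integrableOn_Ioi_rpow_of_lt (by linarith) hc),
    integral_Ioi_rpow_of_lt (by linarith) hc]
  · congr 1
    rw [show -a - 1 + 1 = -a by ring, neg_div_neg_eq]
  · filter_upwards [ae_restrict_mem measurableSet_Ioi] with t ht
    exact Real.rpow_nonneg (hc.trans ht).le _

theorem besovSeminorm_rpow_le (hT : G.IsTree) {θ p : ℝ} (hp : 1 ≤ p) (hθ : 0 < θ)
    (u : Boundary G o ε → ℝ) :
    besovSeminorm K θ p p u ^ p ≤ ENNReal.ofReal ((2 / ε) ^ (-(θ * p)) / (θ * p)) *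
      ∑' n : ℕ, ENNReal.ofReal (Real.exp (θ * p * ε * n)) * cylinderOsc K p u n := by
  have hε0 := hε.out
  have hp0 : 0 < p := by linarith
  set I : ℕ → Set ℝ := fun n => {t | 2 / ε * Real.exp (-ε * n) < t ∧
    (n = 0 ∨ t ≤ 2 / ε * Real.exp (-ε * (n - 1 : ℝ)))} with hI
  have hIm : ∀ n, MeasurableSet (I n) := by
    intro n
    refine measurableSet_Ioi.inter ?_
    by_cases hn : n = 0
    · simp only [hn, true_or]
      exact MeasurableSet.univ
    · simp only [hn, false_or]
      exact measurableSet_Iic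
  have hsub : Ioi (0 : ℝ) ⊆ ⋃ n, I n := by
    intro t (ht : 0 < t)
    have hlim : Tendsto (fun n : ℕ => 2 / ε * Real.exp (-ε * n)) atTop (𝓝 (2 / ε * 0)) :=
      Tendsto.const_mul _ (Real.tendsto_exp_atBot.comp
        (tendsto_natCast_atTop_atTop.const_mul_atTop_of_neg (by linarith)))
    rw [mul_zero] at hlim
    have hex : ∃ n : ℕ, 2 / ε * Real.exp (-ε * n) < t := (hlim.eventually (gt_mem_nhds ht)).exists
    classical
    refine mem_iUnion.2 ⟨Nat.find hex, Nat.find_spec hex, ?_⟩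
    rcases Nat.eq_zero_or_pos (Nat.find hex) with h | h
    · exact Or.inl h
    · right
      have := Nat.find_min hex (Nat.sub_lt h one_pos)
      rw [not_lt, Nat.cast_pred h] at this
      exact this
  rw [besovSeminorm_rpow θ hp, ← ENNReal.tsum_mul_left]
  refine (lintegral_mono_set hsub).trans ((lintegral_iUnion_le _ _).trans ?_)
  refine ENNReal.tsum_le_tsum fun n => ?_
  rw [setLIntegral_congr_fun (hIm n) fun t ht => besov_integrand_eq hT hp u ht.1 ht.2,
    lintegral_const_mul _ (by fun_prop)]
  have h1 : ∫⁻ t in I n, ENNReal.ofReal (t ^ (-(θ * p) - 1)) ≤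
      ENNReal.ofReal ((2 / ε) ^ (-(θ * p)) / (θ * p)) *
        ENNReal.ofReal (Real.exp (θ * p * ε * n)) := by
    -- Enlarging the interval of radii to a half-line costs only a constant, because `θp > 0` makes
    -- the integral of the power converge at infinity.
    refine (lintegral_mono_set (t := Ioi (2 / ε * Real.exp (-ε * n))) fun t ht => ht.1).trans ?_
    rw [lintegral_Ioi_rpow (by positivity) (by positivity), rpow_neg_two_div_mul_exp hε0,
      ← ENNReal.ofReal_mul (by positivity)]
    exact (congrArg _ (by ring)).le
  calc _ ≤ cylinderOsc K p u n * _ := mul_le_mul' le_rfl h1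
    _ = _ := by ring

/-- On the interval of radii of level `n` the decreasing power of `t` is at least its value at the
right endpoint `d n`, and the interval has length `d n (1 - e^{-ε})`; this gives the constant. For
`n = 0` only the radii up to `(2/ε)e^ε` are used. -/
theorem tsum_cylinderOsc_le (hT : G.IsTree) {θ p : ℝ} (hp : 1 ≤ p) (hθ : 0 < θ)
    (u : Boundary G o ε → ℝ) :
    ENNReal.ofReal ((2 / ε * Real.exp ε) ^ (-(θ * p)) * (1 - Real.exp (-ε))) *
      ∑' n : ℕ, ENNReal.ofReal (Real.exp (θ * p * ε * n)) * cylinderOsc K p u n ≤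
      besovSeminorm K θ p p u ^ p := by
  have hε0 := hε.out
  have hp0 : 0 < p := by linarith
  set d : ℕ → ℝ := fun n => 2 / ε * Real.exp (-ε * (n - 1 : ℝ)) with hd
  have hd1 : ∀ n : ℕ, 2 / ε * Real.exp (-ε * n) = d (n + 1) := by
    intro n; simp [hd]
  have hdanti : Antitone d := by
    refine antitone_nat_of_succ_le fun n => ?_
    simp only [hd, Nat.cast_add, Nat.cast_one]
    gcongr 2 / ε * Real.exp ?_
    nlinarith
  have hdpos : ∀ n, 0 < d n := fun n => by simp only [hd]; positivity
  have hdisj : Pairwise (Function.onFun Disjoint fun n => Ioc (d (n + 1)) (d n)) :=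
    hdanti.pairwise_disjoint_on_Ioc_succ
  have hsub : ⋃ n, Ioc (d (n + 1)) (d n) ⊆ Ioi (0 : ℝ) :=
    iUnion_subset fun n t ht => (hdpos _).trans ht.1
  rw [besovSeminorm_rpow θ hp, ← ENNReal.tsum_mul_left]
  refine le_trans ?_ (lintegral_mono_set hsub)
  rw [lintegral_iUnion (fun n => measurableSet_Ioc) hdisj]
  refine ENNReal.tsum_le_tsum fun n => ?_
  rw [setLIntegral_congr_fun measurableSet_Ioc fun t ht => besov_integrand_eq hT hp u
    (n := n) ((hd1 n).trans_lt ht.1) (Or.inr ht.2), lintegral_const_mul _ (by fun_prop)]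
  have h1 : ENNReal.ofReal ((2 / ε * Real.exp ε) ^ (-(θ * p)) * (1 - Real.exp (-ε))) *
      ENNReal.ofReal (Real.exp (θ * p * ε * n)) ≤
      ∫⁻ t in Ioc (d (n + 1)) (d n), ENNReal.ofReal (t ^ (-(θ * p) - 1)) := by
    calc _ = ENNReal.ofReal (d n ^ (-(θ * p) - 1)) * volume (Ioc (d (n + 1)) (d n)) := by
          rw [Real.volume_Ioc, ← ENNReal.ofReal_mul, ← ENNReal.ofReal_mul]
          · congr 1
            have e1 : d n = 2 / ε * Real.exp ε * Real.exp (-ε * n) := by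
              rw [mul_assoc, ← Real.exp_add]
              exact congrArg (fun y => 2 / ε * Real.exp y) (by ring)
            have e2 : d (n + 1) = d n * Real.exp (-ε) := by
              rw [← hd1, mul_assoc, ← Real.exp_add]
              exact congrArg (fun y => 2 / ε * Real.exp y) (by ring)
            have e3 : d n ^ (-(θ * p)) =
                (2 / ε * Real.exp ε) ^ (-(θ * p)) * Real.exp (θ * p * ε * n) := by
              rw [e1, Real.mul_rpow (by positivity) (by positivity), ← Real.exp_mul]
              congr 2; ring
            rw [e2, Real.rpow_sub_one (hdpos n).ne', e3]
            have := (hdpos n).ne'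
            field_simp
          · exact Real.rpow_nonneg (hdpos n).le _
          · refine mul_nonneg (by positivity) ?_
            rw [sub_nonneg, Real.exp_le_one_iff]
            linarith
      _ = ∫⁻ _ in Ioc (d (n + 1)) (d n), ENNReal.ofReal (d n ^ (-(θ * p) - 1)) := by
          rw [setLIntegral_const]
      _ ≤ _ := by
          refine setLIntegral_mono (by fun_prop) fun t ht => ENNReal.ofReal_le_ofReal ?_
          have h0 : 0 < θ * p := by positivity
          exact Real.rpow_le_rpow_of_nonpos ((hdpos _).trans ht.1) ht.2 (by linarith)
  calc _ = cylinderOsc K p u n * _ := by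
        rw [← mul_assoc, mul_comm]
    _ ≤ _ := mul_le_mul' le_rfl h1

end Besov

/-! ### The trace of a Newtonian function -/

section Trace

variable {V : Type*} {G : SimpleGraph V} {o : V} {K : ℕ} {ε : ℝ}

theorem ofReal_abs_sub_eq_edist (x y : ℝ) : ENNReal.ofReal |x - y| = edist x y := by
  rw [edist_dist, Real.dist_eq]

theorem isProbabilityMeasure_restrict_Ioc (a : ℝ) :
    IsProbabilityMeasure (volume.restrict (Ioc (a - 1) a)) := by
  constructor
  simp

/-- Jensen's inequality on an edge of Lebesgue mass one, followed by a change of the weight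
`e^{-εpt}` into `e^{-βt}` for `n < t ≤ n + 1`. -/
theorem edgeIntegral_rpow_le (hε : 0 < ε) {β p : ℝ} (hβ : 0 ≤ β) (hp : 1 ≤ p) {v : V} {n : ℕ}
    (hv : G.dist o v = n + 1) {g : Point G o → ℝ≥0∞} (hg : Measurable g) :
    edgeIntegral ε g v ^ p ≤ ENNReal.ofReal (Real.exp (β * (n + 1) - ε * p * n)) *
      edgeIntegral β (fun z => g z ^ p) v := by
  have hm := measurable_edgePoint (G := G) (o := o) v
  have := isProbabilityMeasure_restrict_Ioc (G.dist o v)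
  refine (lintegral_rpow_le_of_isProbabilityMeasure _ hp (by fun_prop)).trans ?_
  rw [edgeIntegral, ← lintegral_const_mul _ (by fun_prop)]
  refine setLIntegral_mono (by fun_prop) fun t ht => ?_
  rw [hv] at ht
  push_cast at ht
  rw [ENNReal.mul_rpow_of_nonneg _ _ (by linarith), mul_left_comm,
    ENNReal.ofReal_rpow_of_pos (Real.exp_pos _), ← ENNReal.ofReal_mul (Real.exp_pos _).le,
    ← Real.exp_mul, ← Real.exp_add]
  gcongr
  have h1 : β * t ≤ β * (n + 1) := mul_le_mul_of_nonneg_left ht.2 hβ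
  have h2 : ε * p * n ≤ ε * p * t :=
    mul_le_mul_of_nonneg_left (by linarith [ht.1]) (by positivity)
  nlinarith

theorem tsum_levels (hT : G.IsTree) (F : V → ℝ≥0∞) :
    ∑' n : ℕ, ∑' v : {v | G.dist o v = n + 1}, F v = ∑' v : {v : V // v ≠ o}, F v := by
  classical
  have h1 : ∀ n : ℕ, ∑' v : {v | G.dist o v = n + 1}, F v =
      ∑' v : V, {v | G.dist o v = n + 1}.indicator F v := fun n => tsum_subtype _ F
  have h2 : ∑' v : {v : V // v ≠ o}, F v = ∑' v : V, {v | v ≠ o}.indicator F v :=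
    tsum_subtype {v | v ≠ o} F
  rw [tsum_congr h1, h2, ENNReal.tsum_comm]
  refine tsum_congr fun v => ?_
  by_cases hv : v = o
  · subst hv
    simp [indicator]
  · have hd := dist_eq_dist_parent_add_one hT hv
    rw [tsum_eq_single (G.dist o (parent G o v))]
    · simp [indicator, hv, hd]
    · intro n hn
      rw [indicator_of_notMem]
      intro (h : G.dist o v = n + 1)
      omega

/-- The sum of the edge integrals of `g` along the ray `ζ`, from level `n` on. -/
def rayTail (g : Point G o → ℝ≥0∞) (n : ℕ) (ζ : Boundary G o ε) : ℝ≥0∞ :=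
  ∑' j, edgeIntegral ε g (ζ.vertex (n + j + 1))

theorem Boundary.vertex_succ_ne_root (ζ : Boundary G o ε) (n : ℕ) : ζ.vertex (n + 1) ≠ o :=
  ne_root_of_dist (ζ.dist_vertex (n + 1))

theorem edist_vertexPoint_ray_le (hT : G.IsTree) {f : Point G o → ℝ} {g : Point G o → ℝ≥0∞}
    (hg : IsUpperGradient ε f g) (ζ : Boundary G o ε) {n : ℕ} {t : ℝ≥0} (h : ⌈(t : ℝ)⌉₊ = n + 1) :
    edist (f (vertexPoint G o (ζ.vertex n))) (f (ζ.ray t)) ≤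
      edgeIntegral ε g (ζ.vertex (n + 1)) := by
  have hv : (ζ.ray t).vert = ζ.vertex (n + 1) := by simp [Boundary.ray, h]
  have := hg.edist_le hT (ζ.ray t) (by rw [hv]; exact ζ.vertex_succ_ne_root n)
  rwa [hv, ζ.parent_vertex hT] at this

theorem Boundary.ray_natCast (ζ : Boundary G o ε) (n : ℕ) :
    ζ.ray n = vertexPoint G o (ζ.vertex n) := by
  ext <;> simp [Boundary.ray, vertexPoint, ζ.dist_vertex]

theorem edist_vertexPoint_succ_le (hT : G.IsTree) {f : Point G o → ℝ} {g : Point G o → ℝ≥0∞}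
    (hg : IsUpperGradient ε f g) (ζ : Boundary G o ε) (n : ℕ) :
    edist (f (vertexPoint G o (ζ.vertex n))) (f (vertexPoint G o (ζ.vertex (n + 1)))) ≤
      edgeIntegral ε g (ζ.vertex (n + 1)) := by
  rw [← ζ.ray_natCast (n + 1)]
  refine edist_vertexPoint_ray_le hT hg ζ ?_
  rw [NNReal.coe_natCast, Nat.ceil_natCast]

theorem tendsto_vertexPoint_of_tendsto_ray {f : Point G o → ℝ} {ζ : Boundary G o ε} {l : ℝ}
    (h : Tendsto (fun t : ℝ≥0 => f (ζ.ray t)) atTop (𝓝 l)) :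
    Tendsto (fun n : ℕ => f (vertexPoint G o (ζ.vertex n))) atTop (𝓝 l) := by
  have := h.comp (tendsto_natCast_atTop_atTop (R := ℝ≥0))
  refine this.congr fun n => ?_
  rw [Function.comp_apply, ζ.ray_natCast]

theorem edist_vertexPoint_le_rayTail (hT : G.IsTree) {f : Point G o → ℝ} {g : Point G o → ℝ≥0∞}
    (hg : IsUpperGradient ε f g) {ζ : Boundary G o ε} {l : ℝ}
    (h : Tendsto (fun t : ℝ≥0 => f (ζ.ray t)) atTop (𝓝 l)) (n : ℕ) :
    edist (f (vertexPoint G o (ζ.vertex n))) l ≤ rayTail g n ζ :=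
  edist_le_tsum_of_edist_le_of_tendsto (fun n => edgeIntegral ε g (ζ.vertex (n + 1)))
    (fun n => edist_vertexPoint_succ_le hT hg ζ n) (tendsto_vertexPoint_of_tendsto_ray h) n

theorem tendsto_nat_ceil_sub_one :
    Tendsto (fun t : ℝ≥0 => ⌈(t : ℝ)⌉₊ - 1) atTop atTop := by
  refine (tendsto_sub_atTop_nat 1).comp (tendsto_nat_ceil_atTop.comp ?_)
  exact NNReal.tendsto_coe_atTop.2 tendsto_id

/-- A function whose increments along the edges of a ray tend to zero has the same limit along the
ray as along its vertices. -/
theorem tendsto_ray_of_tendsto_vertexPoint {f : Point G o → ℝ} {ζ : Boundary G o ε} {l : ℝ}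
    (d : ℕ → ℝ≥0∞) (hd : Tendsto d atTop (𝓝 0))
    (hfd : ∀ (n : ℕ) (t : ℝ≥0), ⌈(t : ℝ)⌉₊ = n + 1 →
      edist (f (vertexPoint G o (ζ.vertex n))) (f (ζ.ray t)) ≤ d n)
    (h : Tendsto (fun n : ℕ => f (vertexPoint G o (ζ.vertex n))) atTop (𝓝 l)) :
    Tendsto (fun t : ℝ≥0 => f (ζ.ray t)) atTop (𝓝 l) := by
  rw [tendsto_iff_edist_tendsto_0] at h ⊢
  have h2 := (hd.add h).comp tendsto_nat_ceil_sub_one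
  rw [add_zero] at h2
  refine tendsto_of_tendsto_of_tendsto_of_le_of_le' tendsto_const_nhds h2
    (Eventually.of_forall fun _ => zero_le) ?_
  filter_upwards [eventually_gt_atTop 0] with t ht
  have hc : ⌈(t : ℝ)⌉₊ = (⌈(t : ℝ)⌉₊ - 1) + 1 := by
    have : 0 < ⌈(t : ℝ)⌉₊ := Nat.ceil_pos.2 ht
    omega
  have := hfd _ t hc
  refine (edist_triangle _ _ _).trans (add_le_add ?_ le_rfl)
  rw [edist_comm]
  exact this

/-- A finite tail makes the values at the vertices a Cauchy sequence; its terms tend to zero, which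
handles the interiors of the edges. -/
theorem exists_tendsto_ray (hT : G.IsTree) {f : Point G o → ℝ} {g : Point G o → ℝ≥0∞}
    (hg : IsUpperGradient ε f g) {ζ : Boundary G o ε} (hζ : rayTail g 0 ζ ≠ ∞) :
    ∃ l, Tendsto (fun t : ℝ≥0 => f (ζ.ray t)) atTop (𝓝 l) := by
  have hsum : ∑' n, edgeIntegral ε g (ζ.vertex (n + 1)) ≠ ∞ := by
    simpa [rayTail] using hζ
  obtain ⟨l, hl⟩ := cauchySeq_tendsto_of_complete
    (cauchySeq_of_edist_le_of_tsum_ne_top _ (edist_vertexPoint_succ_le hT hg ζ) hsum)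
  exact ⟨l, tendsto_ray_of_tendsto_vertexPoint _ (ENNReal.tendsto_atTop_zero_of_tsum_ne_top hsum)
    (fun n t h => edist_vertexPoint_ray_le hT hg ζ h) hl⟩

variable [hε : Fact (0 < ε)]

theorem measurable_rayTail [Countable V] (hT : G.IsTree) (g : Point G o → ℝ≥0∞) (n : ℕ) :
    Measurable (rayTail g n : Boundary G o ε → ℝ≥0∞) :=
  Measurable.tsum fun j => measurable_comp_vertex hT (edgeIntegral ε g) (n + j + 1)

theorem exp_natCast_mul_inv_pow (hK : 2 ≤ K) (x : ℝ) (n : ℕ) :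
    ENNReal.ofReal (Real.exp x) * (K : ℝ≥0∞)⁻¹ ^ n =
      ENNReal.ofReal (Real.exp (x - n * Real.log K)) := by
  have hK0 : (0 : ℝ) < K := by positivity
  rw [sub_eq_add_neg, Real.exp_add, ENNReal.ofReal_mul (Real.exp_pos _).le, ← mul_neg,
    Real.exp_nat_mul, Real.exp_neg, Real.exp_log hK0, ENNReal.ofReal_pow (by positivity),
    ENNReal.ofReal_inv_of_pos hK0, ENNReal.ofReal_natCast]

/-- The balance that determines `θ`: the exponents `θpεn`, `β(n+1) - εpn` and `-(n+1) log K` add up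
to `β - log K`, which does not depend on `n`. -/
theorem lintegral_edgeIntegral_rpow_le (hK : 2 ≤ K) (hG : IsKaryTree G o K) {β p θ : ℝ}
    (hβ : 0 ≤ β) (hp : 1 ≤ p) (hθ : θ * p * ε = p * ε - (β - Real.log K))
    {g : Point G o → ℝ≥0∞} (hg : Measurable g) (n : ℕ) :
    ENNReal.ofReal (Real.exp (θ * p * ε * n)) *
      ∫⁻ ζ : Boundary G o ε, edgeIntegral ε g (ζ.vertex (n + 1)) ^ p ∂boundaryMeasure G o K ε ≤
    ENNReal.ofReal (Real.exp (β - Real.log K)) *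
      ∑' v : {v | G.dist o v = n + 1}, edgeIntegral β (fun z => g z ^ p) v := by
  rw [lintegral_comp_vertex hK hG (n + 1) fun v => edgeIntegral ε g v ^ p,
    ← ENNReal.tsum_mul_left, ← ENNReal.tsum_mul_left]
  refine ENNReal.tsum_le_tsum fun v => ?_
  rw [← mul_assoc, exp_natCast_mul_inv_pow hK]
  calc _ ≤ _ := mul_le_mul' le_rfl (edgeIntegral_rpow_le hε.out hβ hp v.2 hg)
    _ = _ := by
      rw [← mul_assoc, ← ENNReal.ofReal_mul (Real.exp_pos _).le, ← Real.exp_add, hθ]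
      congr 3
      push_cast
      ring

/-- The constant in the Hardy inequality for the tails along rays. -/
def tailConst (K : ℕ) (ε β p θ : ℝ) : ℝ≥0∞ :=
  (∑' j, ENNReal.ofReal (Real.exp (-(θ * ε))) ^ j) ^ (p - 1) *
    (∑' j, ENNReal.ofReal (Real.exp (-(θ * ε))) ^ j) *
    ENNReal.ofReal (Real.exp (β - Real.log K))

theorem tailConst_ne_top {β p θ : ℝ} (hp : 1 ≤ p) (hθ : 0 < θ) : tailConst K ε β p θ ≠ ∞ := by
  have h0 := hε.out
  have h : ∑' j, ENNReal.ofReal (Real.exp (-(θ * ε))) ^ j ≠ ∞ := by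
    rw [ENNReal.tsum_geometric, ENNReal.inv_ne_top, Ne, tsub_eq_zero_iff_le, not_le]
    rw [ENNReal.ofReal_lt_one, Real.exp_lt_one_iff, neg_lt_zero]
    positivity
  exact ENNReal.mul_ne_top (ENNReal.mul_ne_top
    (ENNReal.rpow_ne_top_of_nonneg (by linarith) h) h) ENNReal.ofReal_ne_top

/-- The Hardy inequality with ratio `r = e^{-θε}`, for which `r^{-np}` is the Besov weight; the
energies of the levels add up to `∫ g^p dμ`. The term `n = 0` alone yields existence of the limits
and the `L^p` bound. -/
theorem tsum_lintegral_rayTail_le (hK : 2 ≤ K) (hG : IsKaryTree G o K) {β p θ : ℝ}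
    (hβ : 0 ≤ β) (hp : 1 ≤ p) (hθ : θ * p * ε = p * ε - (β - Real.log K))
    {g : Point G o → ℝ≥0∞} (hg : Measurable g) :
    ∑' n : ℕ, ENNReal.ofReal (Real.exp (θ * p * ε * n)) *
      ∫⁻ ζ : Boundary G o ε, rayTail g n ζ ^ p ∂boundaryMeasure G o K ε ≤
    tailConst K ε β p θ * ∫⁻ z, g z ^ p ∂treeMeasure G o β := by
  have := hG.countable
  have hT := hG.isTree
  have hr : ∀ n : ℕ, ((ENNReal.ofReal (Real.exp (-(θ * ε))))⁻¹ ^ p) ^ n =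
      ENNReal.ofReal (Real.exp (θ * p * ε * n)) := by
    intro n
    rw [← ENNReal.ofReal_inv_of_pos (Real.exp_pos _), ← Real.exp_neg, neg_neg,
      ENNReal.ofReal_rpow_of_pos (Real.exp_pos _), ← Real.exp_mul,
      ← ENNReal.ofReal_pow (Real.exp_pos _).le, ← Real.exp_nat_mul]
    congr 2
    ring
  have h := tsum_lintegral_tail_le (boundaryMeasure G o K ε) hp
    (r := ENNReal.ofReal (Real.exp (-(θ * ε)))) (by simp [Real.exp_pos]) ENNReal.ofReal_ne_top
    (fun n ζ => edgeIntegral ε g (ζ.vertex (n + 1)))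
    (fun n => measurable_comp_vertex hT (edgeIntegral ε g) (n + 1))
    (fun n => ENNReal.ofReal (Real.exp (β - Real.log K)) *
      ∑' v : {v | G.dist o v = n + 1}, edgeIntegral β (fun z => g z ^ p) v)
    (fun n => by rw [hr]; exact lintegral_edgeIntegral_rpow_le hK hG hβ hp hθ hg n)
  simp_rw [hr] at h
  refine h.trans (le_of_eq ?_)
  rw [ENNReal.tsum_mul_left, tsum_levels hT fun v => edgeIntegral β (fun z => g z ^ p) v,
    ← lintegral_treeMeasure_eq_tsum hT β (hg.pow_const p), tailConst, mul_assoc _ _ (lintegral _ _)]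

theorem exists_isTrace (hK : 2 ≤ K) (hG : IsKaryTree G o K) {β p θ : ℝ}
    (hβ : 0 ≤ β) (hp : 1 ≤ p) (hθ : θ * p * ε = p * ε - (β - Real.log K)) (hθ0 : 0 < θ)
    {f : Point G o → ℝ} {g : Point G o → ℝ≥0∞} (hg : IsUpperGradient ε f g)
    (hgp : ∫⁻ z, g z ^ p ∂treeMeasure G o β ≠ ∞) : ∃ u : Boundary G o ε → ℝ, IsTrace K f u := by
  have := hG.countable
  have hT := hG.isTree
  have h := (ENNReal.le_tsum 0).trans (tsum_lintegral_rayTail_le hK hG hβ hp hθ hg.1)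
  simp only [CharP.cast_eq_zero, mul_zero, Real.exp_zero, ENNReal.ofReal_one, one_mul] at h
  have hfin := ne_top_of_le_ne_top (ENNReal.mul_ne_top (tailConst_ne_top hp hθ0) hgp) h
  have hae := ae_lt_top ((measurable_rayTail hT g 0).pow_const p) hfin
  have hex : ∀ᵐ ζ ∂boundaryMeasure G o K ε,
      ∃ l, Tendsto (fun t : ℝ≥0 => f (ζ.ray t)) atTop (𝓝 l) := by
    filter_upwards [hae] with ζ hζ
    refine exists_tendsto_ray hT hg fun htop => ?_
    rw [htop, ENNReal.top_rpow_of_pos (by linarith)] at hζ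
    exact lt_irrefl _ hζ
  classical
  -- The value 0 is used only on the null set of rays without a limit.
  refine ⟨fun ζ => if h : ∃ l, Tendsto (fun t : ℝ≥0 => f (ζ.ray t)) atTop (𝓝 l) then h.choose
    else 0, ?_⟩
  rw [IsTrace]
  filter_upwards [hex] with ζ hζ
  rw [dif_pos hζ]
  exact hζ.choose_spec

/-- A trace is an almost everywhere limit of functions of a single vertex, which are measurable
because there are countably many vertices, whatever `f` is. -/
theorem IsTrace.aemeasurable [Countable V] (hT : G.IsTree) {f : Point G o → ℝ}
    {u : Boundary G o ε → ℝ} (h : IsTrace K f u) : AEMeasurable u (boundaryMeasure G o K ε) := by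
  refine aemeasurable_of_tendsto_metrizable_ae atTop
    (fun n => (measurable_comp_vertex hT (fun v => f (vertexPoint G o v)) n).aemeasurable) ?_
  filter_upwards [h] with ζ hζ
  exact tendsto_vertexPoint_of_tendsto_ray hζ

/-! ### Boundedness of the trace map. -/

theorem isProbabilityMeasure_cylinder (hK : 2 ≤ K) (hG : IsKaryTree G o K) (v : V) :
    IsProbabilityMeasure (((boundaryMeasure G o K ε).restrict (cylinder ε v) univ)⁻¹ •
      (boundaryMeasure G o K ε).restrict (cylinder ε v)) := by
  constructor
  rw [Measure.smul_apply, Measure.restrict_apply_univ, boundaryMeasure_cylinder hK hG, smul_eq_mul,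
    ENNReal.inv_mul_cancel]
  · exact pow_ne_zero _ (ENNReal.inv_ne_zero.2 (ENNReal.natCast_ne_top K))
  · exact ENNReal.pow_ne_top (ENNReal.inv_ne_top.2 (by exact_mod_cast (by omega : K ≠ 0)))

/-- Two rays in one cylinder of level `n` share the reference value `c (ζ.vertex n)`, so `|u ζ - u
ξ|` is at most `T ζ + T ξ`. Averaging over cylinders preserves the integral, so both terms
contribute the same, and `2^{p-1} · 2 = 2^p`. For traces, `c` is `f` at the vertices and `T` is
`rayTail g n`. -/
theorem cylinderOsc_le (hK : 2 ≤ K) (hG : IsKaryTree G o K) {p : ℝ} (hp : 1 ≤ p)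
    {u : Boundary G o ε → ℝ} (n : ℕ) (c : V → ℝ) {T : Boundary G o ε → ℝ≥0∞} (hTm : Measurable T)
    (h : ∀ᵐ ζ ∂boundaryMeasure G o K ε, edist (c (ζ.vertex n)) (u ζ) ≤ T ζ) :
    cylinderOsc K p u n ≤ 2 ^ p * ∫⁻ ζ, T ζ ^ p ∂boundaryMeasure G o K ε := by
  have hT := hG.isTree
  have hinner : ∀ᵐ ζ ∂boundaryMeasure G o K ε,
      (⨍⁻ ξ in cylinder ε (ζ.vertex n), ENNReal.ofReal |u ζ - u ξ| ^ p ∂boundaryMeasure G o K ε) ≤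
      2 ^ (p - 1) * (T ζ ^ p +
        ⨍⁻ ξ in cylinder ε (ζ.vertex n), T ξ ^ p ∂boundaryMeasure G o K ε) := by
    filter_upwards [h] with ζ hζ
    have hprob := isProbabilityMeasure_cylinder (ε := ε) hK hG (ζ.vertex n)
    have hae : ∀ᵐ ξ ∂(((boundaryMeasure G o K ε).restrict (cylinder ε (ζ.vertex n)) univ)⁻¹ •
        (boundaryMeasure G o K ε).restrict (cylinder ε (ζ.vertex n))),
        ENNReal.ofReal |u ζ - u ξ| ^ p ≤ 2 ^ (p - 1) * (T ζ ^ p + T ξ ^ p) := by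
      refine Measure.ae_smul_measure ?_ _
      filter_upwards [ae_restrict_of_ae h, ae_restrict_mem (measurableSet_cylinder hT _)]
        with ξ hξ hmem
      rw [mem_cylinder_vertex_iff] at hmem
      rw [hmem] at hξ
      refine le_trans ?_ (add_rpow_le hp _ _)
      refine ENNReal.rpow_le_rpow ?_ (by linarith)
      rw [ofReal_abs_sub_eq_edist]
      refine (edist_triangle_left _ _ (c (ζ.vertex n))).trans (add_le_add hζ hξ)
    refine (lintegral_mono_ae hae).trans (le_of_eq ?_)
    rw [lintegral_const_mul _ (by fun_prop), lintegral_add_left measurable_const, lintegral_const,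
      measure_univ, mul_one, laverage]
  refine (lintegral_mono_ae hinner).trans (le_of_eq ?_)
  have := hG.countable
  rw [lintegral_const_mul' _ _ (ENNReal.rpow_ne_top_of_nonneg (by linarith) (by simp)),
    lintegral_add_left (by fun_prop), lintegral_laverage_cylinder hK hG, ← two_mul, ← mul_assoc]
  congr 1
  conv_rhs => rw [show p = (p - 1) + 1 by ring, ENNReal.rpow_add _ _ (by simp) (by simp),
    ENNReal.rpow_one]

theorem besovSeminorm_trace_le (hK : 2 ≤ K) (hG : IsKaryTree G o K) {β p θ : ℝ}
    (hβ : 0 ≤ β) (hp : 1 ≤ p) (hθ : θ * p * ε = p * ε - (β - Real.log K)) (hθ0 : 0 < θ)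
    {f : Point G o → ℝ} {g : Point G o → ℝ≥0∞} (hg : IsUpperGradient ε f g)
    {u : Boundary G o ε → ℝ} (hu : IsTrace K f u) :
    besovSeminorm K θ p p u ^ p ≤
      ENNReal.ofReal ((2 / ε) ^ (-(θ * p)) / (θ * p)) * (2 ^ p * tailConst K ε β p θ) *
        ∫⁻ z, g z ^ p ∂treeMeasure G o β := by
  have := hG.countable
  have hT := hG.isTree
  refine (besovSeminorm_rpow_le hT hp hθ0 u).trans ?_
  refine le_trans (mul_le_mul' le_rfl ?_) (le_of_eq (mul_assoc _ _ _).symm)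
  calc ∑' n : ℕ, ENNReal.ofReal (Real.exp (θ * p * ε * n)) * cylinderOsc K p u n
      ≤ ∑' n : ℕ, 2 ^ p * (ENNReal.ofReal (Real.exp (θ * p * ε * n)) *
        ∫⁻ ζ : Boundary G o ε, rayTail g n ζ ^ p ∂boundaryMeasure G o K ε) := by
        refine ENNReal.tsum_le_tsum fun n => ?_
        rw [mul_left_comm]
        refine mul_le_mul' le_rfl (cylinderOsc_le hK hG hp n (fun v => f (vertexPoint G o v))
          (measurable_rayTail hT g n) ?_)
        filter_upwards [hu] with ζ hζ
        exact edist_vertexPoint_le_rayTail hT hg hζ n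
    _ ≤ _ := by
        rw [ENNReal.tsum_mul_left, mul_assoc (2 ^ p)]
        exact mul_le_mul' le_rfl (tsum_lintegral_rayTail_le hK hG hβ hp hθ hg.1)

theorem treeMeasure_edge (hT : G.IsTree) {v : V} (hv : v ≠ o) (β : ℝ) :
    treeMeasure G o β {z | z.vert = v} = edgeIntegral β (fun _ : Point G o => 1) v := by
  have hh := Point.measurable_height (G := G) (o := o)
  have hS : MeasurableSet {z : Point G o | z.vert = v} := Point.measurableSet_vert {v}
  rw [treeMeasure, withDensity_apply _ hS, ← setLIntegral_edge_mul_exp hT hv β measurable_const]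
  simp

/-- The value at the root is compared with `f` at every point of one edge below it and then averaged
over that edge. Its `μ`-mass lies between `e^{-β}` and 1; one factor `e^β` comes from dividing by
this mass, the other from `edgeIntegral_rpow_le` at level 0. -/
theorem enorm_root_rpow_le (hK : 2 ≤ K) (hG : IsKaryTree G o K) {β p : ℝ}
    (hβ : 0 ≤ β) (hp : 1 ≤ p) {f : Point G o → ℝ} {g : Point G o → ℝ≥0∞}
    (hg : IsUpperGradient ε f g) :
    ‖f (vertexPoint G o o)‖ₑ ^ p ≤ 2 ^ (p - 1) * ENNReal.ofReal (Real.exp β) ^ 2 *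
      ((∫⁻ z, ENNReal.ofReal |f z| ^ p ∂treeMeasure G o β) +
        ∫⁻ z, g z ^ p ∂treeMeasure G o β) := by
  have hT := hG.isTree
  obtain ⟨v, hv, hpar⟩ := hG.exists_child hK o
  have hd : G.dist o v = 0 + 1 := by
    rw [dist_eq_dist_parent_add_one hT hv, hpar, SimpleGraph.dist_self]
  have hS : MeasurableSet {z : Point G o | z.vert = v} := Point.measurableSet_vert {v}
  have h1 : ∀ z ∈ {z : Point G o | z.vert = v}, ‖f (vertexPoint G o o)‖ₑ ^ p ≤
      2 ^ (p - 1) * (ENNReal.ofReal |f z| ^ p + edgeIntegral ε g v ^ p) := by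
    rintro z (rfl : z.vert = v)
    refine le_trans (ENNReal.rpow_le_rpow ?_ (by linarith)) (add_rpow_le hp _ _)
    have h2 := hg.edist_le hT z hv
    rw [hpar] at h2
    have h3 := edist_triangle (f (vertexPoint G o o)) (f z) 0
    rw [edist_zero_right, edist_zero_right, add_comm, Real.enorm_eq_ofReal_abs (f z)] at h3
    exact h3.trans (add_le_add le_rfl h2)
  set m := treeMeasure G o β {z | z.vert = v} with hm
  have hm1 : m ≤ 1 := by
    rw [hm, treeMeasure_edge hT hv, edgeIntegral]
    calc _ ≤ ∫⁻ _ in Ioc ((G.dist o v : ℝ) - 1) (G.dist o v), (1 : ℝ≥0∞) := by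
          refine setLIntegral_mono measurable_const fun t ht => ?_
          rw [one_mul, ENNReal.ofReal_le_one, Real.exp_le_one_iff]
          rw [hd] at ht
          have : 0 < t := by simpa using ht.1
          nlinarith
      _ = 1 := by simp
  have hm0 : 1 ≤ ENNReal.ofReal (Real.exp β) * m := by
    rw [hm, treeMeasure_edge hT hv, edgeIntegral, ← lintegral_const_mul _ (by fun_prop)]
    calc (1 : ℝ≥0∞) = ∫⁻ _ in Ioc ((G.dist o v : ℝ) - 1) (G.dist o v), (1 : ℝ≥0∞) := by simp
      _ ≤ _ := by
          refine setLIntegral_mono (by fun_prop) fun t ht => ?_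
          rw [one_mul, ← ENNReal.ofReal_mul (Real.exp_pos _).le, ← Real.exp_add,
            ENNReal.one_le_ofReal, Real.one_le_exp_iff]
          rw [hd] at ht
          have : t ≤ 1 := by simpa using ht.2
          nlinarith
  have hE : edgeIntegral ε g v ^ p * m ≤
      ENNReal.ofReal (Real.exp β) * ∫⁻ z, g z ^ p ∂treeMeasure G o β := by
    refine (mul_le_of_le_one_right' hm1).trans
      ((edgeIntegral_rpow_le hε.out hβ hp hd hg.1).trans ?_)
    rw [lintegral_treeMeasure_eq_tsum hT β (hg.1.pow_const p)]
    refine mul_le_mul' (le_of_eq (by simp)) ?_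
    exact ENNReal.le_tsum (f := fun v : {v : V // v ≠ o} =>
      edgeIntegral β (fun z => g z ^ p) v.1) ⟨v, hv⟩
  have h5 : ‖f (vertexPoint G o o)‖ₑ ^ p * m ≤ 2 ^ (p - 1) * (ENNReal.ofReal (Real.exp β) *
      ((∫⁻ z, ENNReal.ofReal |f z| ^ p ∂treeMeasure G o β) +
        ∫⁻ z, g z ^ p ∂treeMeasure G o β)) := by
    rw [hm, ← setLIntegral_const]
    refine (setLIntegral_mono' hS h1).trans ?_
    rw [lintegral_const_mul' _ _ (ENNReal.rpow_ne_top_of_nonneg (by linarith) (by simp)),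
      lintegral_add_right _ measurable_const, setLIntegral_const, mul_add (ENNReal.ofReal _)]
    refine mul_le_mul' le_rfl (add_le_add ((setLIntegral_le_lintegral _ _).trans ?_) hE)
    refine le_mul_of_one_le_left' ?_
    rwa [ENNReal.one_le_ofReal, Real.one_le_exp_iff]
  calc ‖f (vertexPoint G o o)‖ₑ ^ p = ‖f (vertexPoint G o o)‖ₑ ^ p * 1 := (mul_one _).symm
    _ ≤ ‖f (vertexPoint G o o)‖ₑ ^ p * (ENNReal.ofReal (Real.exp β) * m) :=
        mul_le_mul' le_rfl hm0
    _ = ENNReal.ofReal (Real.exp β) * (‖f (vertexPoint G o o)‖ₑ ^ p * m) := by ring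
    _ ≤ _ := by
        refine (mul_le_mul' le_rfl h5).trans (le_of_eq (by ring))

theorem lintegral_trace_rpow_le (hK : 2 ≤ K) (hG : IsKaryTree G o K) {β p θ : ℝ}
    (hβ : 0 ≤ β) (hp : 1 ≤ p) (hθ : θ * p * ε = p * ε - (β - Real.log K))
    {f : Point G o → ℝ} {g : Point G o → ℝ≥0∞} (hg : IsUpperGradient ε f g)
    {u : Boundary G o ε → ℝ} (hu : IsTrace K f u) :
    ∫⁻ ζ, ‖u ζ‖ₑ ^ p ∂boundaryMeasure G o K ε ≤
      2 ^ (p - 1) * (2 ^ (p - 1) * ENNReal.ofReal (Real.exp β) ^ 2 + tailConst K ε β p θ) *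
      ((∫⁻ z, ENNReal.ofReal |f z| ^ p ∂treeMeasure G o β) +
        ∫⁻ z, g z ^ p ∂treeMeasure G o β) := by
  have hT := hG.isTree
  have := hG.countable
  have hprob := isProbabilityMeasure_boundaryMeasure (ε := ε) hK hG
  have h1 : ∀ᵐ ζ ∂boundaryMeasure G o K ε, ‖u ζ‖ₑ ^ p ≤
      2 ^ (p - 1) * (‖f (vertexPoint G o o)‖ₑ ^ p + rayTail g 0 ζ ^ p) := by
    filter_upwards [hu] with ζ hζ
    refine le_trans (ENNReal.rpow_le_rpow ?_ (by linarith)) (add_rpow_le hp _ _)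
    have h2 := edist_vertexPoint_le_rayTail hT hg hζ 0
    rw [ζ.vertex_zero] at h2
    have h3 := edist_triangle_left (u ζ) 0 (f (vertexPoint G o o))
    rw [edist_zero_right, edist_zero_right, add_comm] at h3
    exact h3.trans (add_le_add le_rfl h2)
  have h4 := (ENNReal.le_tsum 0).trans (tsum_lintegral_rayTail_le (ε := ε) hK hG hβ hp hθ hg.1)
  simp only [CharP.cast_eq_zero, mul_zero, Real.exp_zero, ENNReal.ofReal_one, one_mul] at h4
  refine (lintegral_mono_ae h1).trans ?_
  rw [lintegral_const_mul' _ _ (ENNReal.rpow_ne_top_of_nonneg (by linarith) (by simp)),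
    lintegral_add_left measurable_const, lintegral_const, measure_univ, mul_one, mul_assoc, add_mul]
  refine mul_le_mul' le_rfl (add_le_add (enorm_root_rpow_le hK hG hβ hp hg)
    (h4.trans (mul_le_mul' le_rfl le_add_self)))

end Trace

/-! ### The extension of a function on the vertices to the tree -/

section Extension

variable {V : Type*} {G : SimpleGraph V} {o : V} {K : ℕ} {ε : ℝ}

/-- The function on the tree that agrees with `a` at the vertices and is affine on the edges. -/
def edgeExtension (a : V → ℝ) (x : Point G o) : ℝ :=
  a (parent G o x.vert) +
    (x.height - (G.dist o x.vert - 1)) * (a x.vert - a (parent G o x.vert))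

/-- The modulus of the slope of `edgeExtension a`, with respect to the metric `d_X`. -/
def edgeSlope (ε : ℝ) (a : V → ℝ) (x : Point G o) : ℝ≥0∞ :=
  edist (a x.vert) (a (parent G o x.vert)) * ENNReal.ofReal (Real.exp (ε * x.height))

@[simp] theorem edgeExtension_vertexPoint (a : V → ℝ) (v : V) :
    edgeExtension a (vertexPoint G o v) = a v := by
  simp [edgeExtension, vertexPoint]

theorem measurable_edgeExtension (a : V → ℝ) :
    Measurable (edgeExtension a : Point G o → ℝ) := by
  have h1 := Point.measurable_height (G := G) (o := o)
  have h2 := Point.measurable_comp_vert (G := G) (o := o) fun v => a (parent G o v)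
  have h3 := Point.measurable_comp_vert (G := G) (o := o) fun v => a v - a (parent G o v)
  have h4 := Point.measurable_comp_vert (G := G) (o := o) fun v => (G.dist o v : ℝ) - 1
  exact h2.add ((h1.sub h4).mul h3)

theorem measurable_edgeSlope (a : V → ℝ) : Measurable (edgeSlope ε a : Point G o → ℝ≥0∞) := by
  have h1 := Point.measurable_height (G := G) (o := o)
  have h2 := Point.measurable_comp_vert (G := G) (o := o) fun v => edist (a v) (a (parent G o v))
  exact h2.mul (by fun_prop)

theorem lengthMeasure_edge_le (hT : G.IsTree) {v : V} (hv : v ≠ o) {h : ℝ}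
    (h1 : h ≤ G.dist o v) :
    lengthMeasure G o ({z | z.height ≤ h} ∩ {z | z.vert = v}) =
      ENNReal.ofReal (h - (G.dist o v - 1)) := by
  have hS : MeasurableSet {z : Point G o | z.height ≤ h} :=
    measurableSet_le Point.measurable_height measurable_const
  rw [← Measure.restrict_apply hS, ← lintegral_indicator_one hS,
    setLIntegral_edge hT hv (measurable_one.indicator hS), ← Real.volume_Ioc]
  have : Ioc ((G.dist o v : ℝ) - 1) h = Iic h ∩ Ioc ((G.dist o v : ℝ) - 1) (G.dist o v) := by
    ext t
    simp only [mem_Ioc, mem_inter_iff, mem_Iic]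
    constructor
    · rintro ⟨h2, h3⟩; exact ⟨h3, h2, h3.trans h1⟩
    · rintro ⟨h2, h3, -⟩; exact ⟨h3, h2⟩
  rw [this, ← Measure.restrict_apply measurableSet_Iic, ← lintegral_indicator_one measurableSet_Iic]
  refine setLIntegral_congr_fun measurableSet_Ioc fun t ht => ?_
  simp [indicator, (edgePoint_spec hT hv ht).2]

theorem segment_eq_union (hT : G.IsTree) {x : Point G o} (hx : x.vert ≠ o) :
    segment x = segment (vertexPoint G o (parent G o x.vert)) ∪
      ({z | z.height ≤ x.height} ∩ {z | z.vert = x.vert}) := by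
  have hd := dist_eq_dist_parent_add_one hT hx
  have hpx : (vertexPoint G o (parent G o x.vert)).Anc x := by
    rw [Point.anc_iff hT]
    have h1 := Point.lt_height hx hT
    rw [hd] at h1
    push_cast at h1
    refine ⟨by simp only [vertexPoint]; linarith, ?_⟩
    have := above_pred (G := G) (o := o) (v := x.vert)
    rw [hd, Nat.add_sub_cancel] at this
    exact this
  ext z
  constructor
  · intro (hz : z.Anc x)
    rcases le_or_gt z.height (G.dist o (parent G o x.vert)) with h | h
    · exact Or.inl (hz.of_height_le hT hpx h)
    · right
      rw [Point.anc_iff hT] at hz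
      refine ⟨hz.1, ?_⟩
      have h1 : G.dist o z.vert = G.dist o x.vert := by
        refine le_antisymm (Point.dist_le_of_height_le hz.1) ?_
        have h2 := h.trans_le z.height_le
        have h3 : G.dist o (parent G o x.vert) < G.dist o z.vert := by exact_mod_cast h2
        omega
      have h2 := hz.2
      rw [h1, above_self] at h2
      exact h2.symm
  · rintro (hz | ⟨h1, h2⟩)
    · exact Point.Anc.trans hT hz hpx
    · refine (Point.anc_iff hT).2 ⟨h1, ?_⟩
      rw [mem_ofPred_eq] at h2
      rw [h2, above_self]

/-- The fundamental theorem of calculus on `[0, x]`, by induction on the level: the edge containing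
`x` contributes its constant slope times the length covered. -/
theorem integrableOn_segment_and_integral (hT : G.IsTree) (a : V → ℝ) (x : Point G o) :
    IntegrableOn (fun z => a z.vert - a (parent G o z.vert)) (segment x) (lengthMeasure G o) ∧
      ∫ z in segment x, (a z.vert - a (parent G o z.vert)) ∂lengthMeasure G o =
        edgeExtension a x - a o := by
  induction hn : G.dist o x.vert generalizing x with
  | zero =>
    have hx : x.vert = o := (hT.connected.dist_eq_zero_iff.1 hn).symm
    have hh : x.height ≤ 0 := by have := x.height_le; rwa [hn, Nat.cast_zero] at this
    have h0 : lengthMeasure G o (segment x) = 0 := by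
      refine measure_mono_null (fun z hz => ?_) (lengthMeasure_height_eq hT 0)
      exact le_antisymm (hz.1.trans hh) z.height_nonneg
    constructor
    · rw [IntegrableOn, Measure.restrict_eq_zero.2 h0]
      exact integrable_zero_measure
    -- The root is its own `parent`, so the slope term of the extension vanishes there.
    · rw [Measure.restrict_eq_zero.2 h0, integral_zero_measure, edgeExtension, hx, parent_root]
      simp
  | succ n ih =>
    have hx : x.vert ≠ o := ne_root_of_dist hn
    have hd := dist_eq_dist_parent_add_one hT hx
    set y := vertexPoint G o (parent G o x.vert) with hy
    obtain ⟨ih1, ih2⟩ := ih y (show G.dist o (parent G o x.vert) = n by omega)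
    set S : Set (Point G o) := {z | z.height ≤ x.height} ∩ {z | z.vert = x.vert} with hS
    have hSm : MeasurableSet S := (measurableSet_le Point.measurable_height measurable_const).inter
      (Point.measurableSet_vert {x.vert})
    have hLS : lengthMeasure G o S = ENNReal.ofReal (x.height - (G.dist o x.vert - 1)) :=
      lengthMeasure_edge_le hT hx x.height_le
    have hcongr : EqOn (fun z : Point G o => a z.vert - a (parent G o z.vert))
        (fun _ => a x.vert - a (parent G o x.vert)) S := by
      rintro z ⟨-, hz : z.vert = x.vert⟩
      simp only [hz]
    have hint : IntegrableOn (fun z => a z.vert - a (parent G o z.vert)) S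
        (lengthMeasure G o) := by
      refine IntegrableOn.congr_fun ?_ hcongr.symm hSm
      exact integrableOn_const (by rw [hLS]; exact ENNReal.ofReal_ne_top)
    have hdisj : Disjoint (segment y) S := by
      rw [Set.disjoint_left]
      rintro z hz ⟨-, hz' : z.vert = x.vert⟩
      have h1 : z.height ≤ G.dist o (parent G o x.vert) := hz.1
      have h2 := Point.lt_height (x := z) (by rwa [hz']) hT
      rw [hz', hd] at h2
      push_cast at h2
      linarith
    rw [segment_eq_union hT hx]
    refine ⟨ih1.union hint, ?_⟩
    rw [setIntegral_union hdisj hSm ih1 hint, ih2, setIntegral_congr_fun hSm hcongr,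
      setIntegral_const, measureReal_def, hLS, ENNReal.toReal_ofReal, hy,
      edgeExtension_vertexPoint, edgeExtension, smul_eq_mul]
    · ring
    · linarith [Point.lt_height hx hT]

/-- In the difference of the integrals over `[0, x]` and `[0, y]` the common part cancels. What
remains lies on the geodesic, and the factor `e^{ε|z|}` of the slope cancels the density of
`d_X`-length. -/
theorem isUpperGradient_edgeSlope (hT : G.IsTree) (a : V → ℝ) :
    IsUpperGradient (G := G) (o := o) ε (edgeExtension a) (edgeSlope ε a) := by
  refine ⟨measurable_edgeSlope a, fun x y => ?_⟩
  obtain ⟨ix, ex⟩ := integrableOn_segment_and_integral hT a x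
  obtain ⟨iy, ey⟩ := integrableOn_segment_and_integral hT a y
  have hmx := measurableSet_segment x
  have hmy := measurableSet_segment y
  set s : Point G o → ℝ := fun z => a z.vert - a (parent G o z.vert) with hs
  have e1 := integral_inter_add_sdiff hmy ix
  have e2 := integral_inter_add_sdiff hmx iy
  rw [inter_comm] at e2
  have e3 : edgeExtension a x - edgeExtension a y =
      ∫ z in segment x \ segment y, s z ∂lengthMeasure G o -
        ∫ z in segment y \ segment x, s z ∂lengthMeasure G o := by linarith
  have h1 : ∀ S : Set (Point G o), ‖∫ z in S, s z ∂lengthMeasure G o‖ₑ ≤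
      ∫⁻ z in S, edgeSlope ε a z * ENNReal.ofReal (Real.exp (-ε * z.height))
        ∂lengthMeasure G o := by
    intro S
    refine (enorm_integral_le_lintegral_enorm _).trans (le_of_eq (lintegral_congr fun z => ?_))
    rw [edgeSlope, mul_assoc, ← ENNReal.ofReal_mul (Real.exp_pos _).le, ← Real.exp_add]
    simp [hs, edist_eq_enorm_sub]
  rw [← Real.enorm_eq_ofReal_abs, e3]
  refine enorm_sub_le.trans ((add_le_add (h1 _) (h1 _)).trans ?_)
  rw [← lintegral_union (hmy.diff hmx)
    (disjoint_sdiff_sdiff)]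
  exact lintegral_mono_set (segment_diff_subset_geodesic hT x y)

theorem exists_edgeExtension_eq (hT : G.IsTree) (a : V → ℝ) {x : Point G o} (hx : x.vert ≠ o) :
    ∃ c ∈ Icc (0 : ℝ) 1, edgeExtension a x =
      a (parent G o x.vert) + c * (a x.vert - a (parent G o x.vert)) :=
  ⟨x.height - (G.dist o x.vert - 1), ⟨by linarith [Point.lt_height hx hT],
    by linarith [x.height_le]⟩, rfl⟩

theorem edist_edgeExtension_le (hT : G.IsTree) (a : V → ℝ) {x : Point G o} (hx : x.vert ≠ o) :
    edist (a (parent G o x.vert)) (edgeExtension a x) ≤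
      edist (a x.vert) (a (parent G o x.vert)) := by
  obtain ⟨c, hc, e⟩ := exists_edgeExtension_eq hT a hx
  rw [e, edist_dist, edist_dist, Real.dist_eq, Real.dist_eq, sub_add_cancel_left, abs_neg, abs_mul,
    abs_of_nonneg hc.1]
  exact ENNReal.ofReal_le_ofReal (mul_le_of_le_one_left (abs_nonneg _) hc.2)

theorem enorm_edgeExtension_le (hT : G.IsTree) (a : V → ℝ) {x : Point G o} (hx : x.vert ≠ o) :
    ‖edgeExtension a x‖ₑ ≤ ‖a x.vert‖ₑ + ‖a (parent G o x.vert)‖ₑ := by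
  obtain ⟨c, hc, e⟩ := exists_edgeExtension_eq hT a hx
  rw [Real.enorm_eq_ofReal_abs, Real.enorm_eq_ofReal_abs, Real.enorm_eq_ofReal_abs,
    ← ENNReal.ofReal_add (abs_nonneg _) (abs_nonneg _)]
  refine ENNReal.ofReal_le_ofReal ?_
  rw [e, show a (parent G o x.vert) + c * (a x.vert - a (parent G o x.vert)) =
    c * a x.vert + (1 - c) * a (parent G o x.vert) by ring]
  refine (abs_add_le _ _).trans ?_
  rw [abs_mul, abs_mul, abs_of_nonneg hc.1, abs_of_nonneg (sub_nonneg.2 hc.2)]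
  exact add_le_add (mul_le_of_le_one_left (abs_nonneg _) hc.2)
    (mul_le_of_le_one_left (abs_nonneg _) (by linarith [hc.1]))

theorem edgeIntegral_le_of_le (hT : G.IsTree) {β : ℝ} (hβ : 0 ≤ β) {v : V} {n : ℕ}
    (hv : G.dist o v = n + 1) {F : Point G o → ℝ≥0∞} {c : ℝ≥0∞}
    (h : ∀ z : Point G o, z.vert = v → F z ≤ c) :
    edgeIntegral β F v ≤ c * ENNReal.ofReal (Real.exp (-β * n)) := by
  have := isProbabilityMeasure_restrict_Ioc (G.dist o v)
  calc edgeIntegral β F v ≤ ∫⁻ _ in Ioc ((G.dist o v : ℝ) - 1) (G.dist o v),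
        c * ENNReal.ofReal (Real.exp (-β * n)) := by
        refine setLIntegral_mono measurable_const fun t ht => ?_
        refine mul_le_mul' (h _ (edgePoint_spec hT (ne_root_of_dist hv) ht).1) ?_
        refine ENNReal.ofReal_le_ofReal (Real.exp_le_exp.2 ?_)
        rw [hv] at ht
        push_cast at ht
        nlinarith [ht.1]
    _ = _ := by rw [lintegral_const, measure_univ, mul_one]

variable [hε : Fact (0 < ε)]

/-- A sum over the vertices of level `n + 1`, as an integral over the boundary. -/
theorem tsum_level_eq (hK : 2 ≤ K) (hG : IsKaryTree G o K) (n : ℕ) (h : V → V → ℝ≥0∞) :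
    ∑' v : {v | G.dist o v = n + 1}, h v (parent G o v) =
      (K : ℝ≥0∞) ^ (n + 1) * ∫⁻ ζ : Boundary G o ε, h (ζ.vertex (n + 1)) (ζ.vertex n)
        ∂boundaryMeasure G o K ε := by
  have h1 := lintegral_comp_vertex (ε := ε) hK hG (n + 1) fun v => h v (parent G o v)
  simp_rw [Boundary.parent_vertex hG.isTree] at h1
  rw [h1, ENNReal.tsum_mul_left, ← mul_assoc, ← mul_pow, ENNReal.mul_inv_cancel, one_pow, one_mul]
  · exact_mod_cast (by omega : K ≠ 0)
  · exact ENNReal.natCast_ne_top K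

theorem exp_mul_natCast_pow (hK : 2 ≤ K) (x : ℝ) (n : ℕ) :
    ENNReal.ofReal (Real.exp x) * (K : ℝ≥0∞) ^ n =
      ENNReal.ofReal (Real.exp (x + n * Real.log K)) := by
  have hK0 : (0 : ℝ) < K := by positivity
  rw [Real.exp_add, ENNReal.ofReal_mul (Real.exp_pos _).le, Real.exp_nat_mul, Real.exp_log hK0,
    ENNReal.ofReal_pow (by positivity), ENNReal.ofReal_natCast]

/-- The same balance in the other direction: slope factor `e^{pε(n+1)}`, mass at most `e^{-βn}` and
`K^{n+1}` edges multiply to `e^{θpεn}` times `e^{pε + log K}`. -/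
theorem lintegral_edgeSlope_rpow_le (hK : 2 ≤ K) (hG : IsKaryTree G o K) {β p θ : ℝ}
    (hβ : 0 ≤ β) (hp : 1 ≤ p) (hθ : θ * p * ε = p * ε - (β - Real.log K)) (a : V → ℝ) :
    ∫⁻ z : Point G o, edgeSlope ε a z ^ p ∂treeMeasure G o β ≤
      ENNReal.ofReal (Real.exp (p * ε + Real.log K)) *
        ∑' n : ℕ, ENNReal.ofReal (Real.exp (θ * p * ε * n)) *
          ∫⁻ ζ : Boundary G o ε, edist (a (ζ.vertex (n + 1))) (a (ζ.vertex n)) ^ p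
            ∂boundaryMeasure G o K ε := by
  have hT := hG.isTree
  have hε0 := hε.out
  have hp0 : 0 ≤ p := by linarith
  rw [lintegral_treeMeasure_eq_tsum hT β ((measurable_edgeSlope a).pow_const p),
    ← tsum_levels hT fun v => edgeIntegral β (fun z : Point G o => edgeSlope ε a z ^ p) v,
    ← ENNReal.tsum_mul_left]
  refine ENNReal.tsum_le_tsum fun n => ?_
  calc ∑' v : {v | G.dist o v = n + 1}, edgeIntegral β (fun z : Point G o => edgeSlope ε a z ^ p) v
      ≤ ∑' v : {v | G.dist o v = n + 1}, ENNReal.ofReal (Real.exp (p * ε * (n + 1) - β * n)) *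
          edist (a v) (a (parent G o v)) ^ p := by
        refine ENNReal.tsum_le_tsum ?_
        rintro ⟨v, hv : G.dist o v = n + 1⟩
        refine (edgeIntegral_le_of_le hT hβ hv (c := edist (a v) (a (parent G o v)) ^ p *
          ENNReal.ofReal (Real.exp (p * ε * (n + 1)))) fun z hz => ?_).trans (le_of_eq ?_)
        · rw [edgeSlope, hz, ENNReal.mul_rpow_of_nonneg _ _ hp0,
            ENNReal.ofReal_rpow_of_pos (Real.exp_pos _), ← Real.exp_mul]
          refine mul_le_mul' le_rfl (ENNReal.ofReal_le_ofReal (Real.exp_le_exp.2 ?_))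
          have h1 := z.height_le
          rw [hz, hv] at h1
          push_cast at h1
          have := mul_le_mul_of_nonneg_left h1 (mul_nonneg hp0 hε0.le)
          linarith
        · rw [mul_assoc, ← ENNReal.ofReal_mul (Real.exp_pos _).le, ← Real.exp_add, mul_comm]
          congr 3
          ring
    _ = _ := by
        rw [ENNReal.tsum_mul_left, tsum_level_eq (ε := ε) hK hG n fun v w => edist (a v) (a w) ^ p,
          ← mul_assoc, ← mul_assoc, exp_mul_natCast_pow hK,
          ← ENNReal.ofReal_mul (Real.exp_pos _).le, ← Real.exp_add, hθ]
        congr 3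
        push_cast
        ring

/-- Level `n` contributes about `Kⁿe^{-βn}`, a geometric term with ratio `e^{-(β - log K)}`; the
series converges precisely when `β > log K`. -/
theorem lintegral_edgeExtension_rpow_le (hK : 2 ≤ K) (hG : IsKaryTree G o K) {β p : ℝ}
    (hβ : 0 ≤ β) (hp : 1 ≤ p) (a : V → ℝ) {U : ℝ≥0∞}
    (hU : ∀ n, ∫⁻ ζ : Boundary G o ε, ‖a (ζ.vertex n)‖ₑ ^ p ∂boundaryMeasure G o K ε ≤ U) :
    ∫⁻ z : Point G o, ENNReal.ofReal |edgeExtension a z| ^ p ∂treeMeasure G o β ≤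
      2 ^ p * K * (∑' n : ℕ, ENNReal.ofReal (Real.exp (-(β - Real.log K))) ^ n) * U := by
  have hT := hG.isTree
  have := hG.countable
  have hp0 : 0 ≤ p := by linarith
  simp_rw [← Real.enorm_eq_ofReal_abs]
  rw [lintegral_treeMeasure_eq_tsum hT β ((measurable_edgeExtension a).enorm.pow_const p),
    ← tsum_levels hT fun v => edgeIntegral β (fun z : Point G o => ‖edgeExtension a z‖ₑ ^ p) v,
    ← ENNReal.tsum_mul_left, ← ENNReal.tsum_mul_right]
  refine ENNReal.tsum_le_tsum fun n => ?_
  calc ∑' v : {v | G.dist o v = n + 1},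
        edgeIntegral β (fun z : Point G o => ‖edgeExtension a z‖ₑ ^ p) v
      ≤ ∑' v : {v | G.dist o v = n + 1}, ENNReal.ofReal (Real.exp (-β * n)) * 2 ^ (p - 1) *
          (‖a v‖ₑ ^ p + ‖a (parent G o v)‖ₑ ^ p) := by
        refine ENNReal.tsum_le_tsum ?_
        rintro ⟨v, hv : G.dist o v = n + 1⟩
        refine (edgeIntegral_le_of_le hT hβ hv (c := 2 ^ (p - 1) *
          (‖a v‖ₑ ^ p + ‖a (parent G o v)‖ₑ ^ p)) fun z hz => ?_).trans (le_of_eq (by ring))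
        refine le_trans (ENNReal.rpow_le_rpow ?_ hp0) (add_rpow_le hp _ _)
        subst hz
        exact enorm_edgeExtension_le hT a (ne_root_of_dist hv)
    _ = ENNReal.ofReal (Real.exp (-β * n)) * K ^ n * K * 2 ^ (p - 1) *
          ((∫⁻ ζ : Boundary G o ε, ‖a (ζ.vertex (n + 1))‖ₑ ^ p ∂boundaryMeasure G o K ε) +
            ∫⁻ ζ : Boundary G o ε, ‖a (ζ.vertex n)‖ₑ ^ p ∂boundaryMeasure G o K ε) := by
        rw [ENNReal.tsum_mul_left,
          tsum_level_eq (ε := ε) hK hG n fun v w => ‖a v‖ₑ ^ p + ‖a w‖ₑ ^ p,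
          lintegral_add_left (measurable_comp_vertex hT (fun v => ‖a v‖ₑ ^ p) (n + 1)), pow_succ]
        ring
    _ ≤ ENNReal.ofReal (Real.exp (-β * n)) * K ^ n * K * 2 ^ (p - 1) * (U + U) :=
        mul_le_mul' le_rfl (add_le_add (hU _) (hU _))
    _ = _ := by
        have h2 : (2 : ℝ≥0∞) ^ p = 2 ^ (p - 1) * 2 := by
          conv_lhs => rw [show p = (p - 1) + 1 by ring, ENNReal.rpow_add _ _ (by simp) (by simp),
            ENNReal.rpow_one]
        rw [exp_mul_natCast_pow hK, h2, ← ENNReal.ofReal_pow (Real.exp_pos _).le, ← Real.exp_nat_mul,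
          show (n : ℝ) * -(β - Real.log K) = -β * n + n * Real.log K by ring]
        ring

end Extension

/-! ### Averages over cylinders -/

section Averages

variable {V : Type*} {G : SimpleGraph V} {o : V} {K : ℕ} {ε : ℝ} [hε : Fact (0 < ε)]

/-- The average of `u` over the cylinder of `v`. -/
def cylinderAverage (K : ℕ) (u : Boundary G o ε → ℝ) (v : V) : ℝ :=
  ⨍ ζ in cylinder ε v, u ζ ∂boundaryMeasure G o K ε

theorem enorm_average_rpow_le {Ω : Type*} [MeasurableSpace Ω] {μ : Measure Ω}
    [IsProbabilityMeasure μ] {p : ℝ} (hp : 1 ≤ p) {u : Ω → ℝ} (hu : AEMeasurable u μ) :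
    ‖∫ x, u x ∂μ‖ₑ ^ p ≤ ∫⁻ x, ‖u x‖ₑ ^ p ∂μ :=
  (ENNReal.rpow_le_rpow (enorm_integral_le_lintegral_enorm u) (by linarith)).trans
    (lintegral_rpow_le_of_isProbabilityMeasure μ hp hu.enorm)

theorem aemeasurable_cylinder {u : Boundary G o ε → ℝ}
    (hu : AEMeasurable u (boundaryMeasure G o K ε)) (v : V) :
    AEMeasurable u (((boundaryMeasure G o K ε).restrict (cylinder ε v) univ)⁻¹ •
      (boundaryMeasure G o K ε).restrict (cylinder ε v)) :=
  hu.restrict.smul_measure _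

theorem enorm_cylinderAverage_rpow_le (hK : 2 ≤ K) (hG : IsKaryTree G o K) {p : ℝ} (hp : 1 ≤ p)
    {u : Boundary G o ε → ℝ} (hu : AEMeasurable u (boundaryMeasure G o K ε)) (v : V) :
    ‖cylinderAverage K u v‖ₑ ^ p ≤
      ⨍⁻ ζ in cylinder ε v, ‖u ζ‖ₑ ^ p ∂boundaryMeasure G o K ε := by
  have := isProbabilityMeasure_cylinder (ε := ε) hK hG v
  exact enorm_average_rpow_le hp (aemeasurable_cylinder hu v)

/-- Jensen's inequality for `c - u`. With `c = u ζ` and the cylinder around `ζ`, the right side is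
the inner average of `cylinderOsc`. -/
theorem edist_cylinderAverage_rpow_le (hK : 2 ≤ K) (hG : IsKaryTree G o K) {p : ℝ} (hp : 1 ≤ p)
    {u : Boundary G o ε → ℝ} (hu : Integrable u (boundaryMeasure G o K ε)) (c : ℝ) (v : V) :
    edist c (cylinderAverage K u v) ^ p ≤
      ⨍⁻ ζ in cylinder ε v, ENNReal.ofReal |c - u ζ| ^ p ∂boundaryMeasure G o K ε := by
  have hprob := isProbabilityMeasure_cylinder (ε := ε) hK hG v
  set m := ((boundaryMeasure G o K ε).restrict (cylinder ε v) univ)⁻¹ •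
      (boundaryMeasure G o K ε).restrict (cylinder ε v) with hm
  have hfin : ((boundaryMeasure G o K ε).restrict (cylinder ε v) univ)⁻¹ ≠ ∞ := by
    rw [Measure.restrict_apply_univ, boundaryMeasure_cylinder hK hG, ENNReal.inv_ne_top]
    exact pow_ne_zero _ (ENNReal.inv_ne_zero.2 (ENNReal.natCast_ne_top K))
  have hum : Integrable u m := hu.restrict.smul_measure hfin
  have h1 : c - cylinderAverage K u v = ∫ ζ, (c - u ζ) ∂m := by
    rw [integral_sub (integrable_const c) hum, integral_const, probReal_univ, one_smul]
    rfl
  have h2 := enorm_average_rpow_le hp (μ := m) (u := fun ζ => c - u ζ)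
    (hum.aestronglyMeasurable.aemeasurable.const_sub c)
  rw [← h1, ← edist_eq_enorm_sub] at h2
  refine h2.trans (le_of_eq (lintegral_congr fun ζ => ?_))
  rw [Real.enorm_eq_ofReal_abs]

theorem lintegral_cylinderAverage_rpow_le (hK : 2 ≤ K) (hG : IsKaryTree G o K) {p : ℝ} (hp : 1 ≤ p)
    {u : Boundary G o ε → ℝ} (hu : AEMeasurable u (boundaryMeasure G o K ε)) (n : ℕ) :
    ∫⁻ ζ : Boundary G o ε, ‖cylinderAverage K u (ζ.vertex n)‖ₑ ^ p ∂boundaryMeasure G o K ε ≤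
      ∫⁻ ζ, ‖u ζ‖ₑ ^ p ∂boundaryMeasure G o K ε := by
  rw [← lintegral_laverage_cylinder hK hG n fun ζ => ‖u ζ‖ₑ ^ p]
  exact lintegral_mono fun ζ => enorm_cylinderAverage_rpow_le hK hG hp hu _

theorem lintegral_edist_cylinderAverage_le (hK : 2 ≤ K) (hG : IsKaryTree G o K) {p : ℝ}
    (hp : 1 ≤ p) {u : Boundary G o ε → ℝ} (hu : Integrable u (boundaryMeasure G o K ε)) (n : ℕ) :
    ∫⁻ ζ : Boundary G o ε, edist (u ζ) (cylinderAverage K u (ζ.vertex n)) ^ p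
      ∂boundaryMeasure G o K ε ≤ cylinderOsc K p u n :=
  lintegral_mono fun ζ => edist_cylinderAverage_rpow_le hK hG hp hu (u ζ) _

/-- Summable oscillations make `∑ |u - average|^p` integrable, hence finite almost everywhere, and
its terms then tend to zero; no differentiation theorem is involved. -/
theorem ae_tendsto_cylinderAverage (hK : 2 ≤ K) (hG : IsKaryTree G o K) {p : ℝ}
    (hp : 1 ≤ p) {u : Boundary G o ε → ℝ} (hu : Integrable u (boundaryMeasure G o K ε))
    (hosc : ∑' n, cylinderOsc K p u n ≠ ∞) :
    ∀ᵐ ζ ∂boundaryMeasure G o K ε,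
      Tendsto (fun n => cylinderAverage K u (ζ.vertex n)) atTop (𝓝 (u ζ)) := by
  have := hG.countable
  have hp0 : 0 < p := by linarith
  have hmeas : ∀ n : ℕ, AEMeasurable
      (fun ζ : Boundary G o ε => edist (u ζ) (cylinderAverage K u (ζ.vertex n)) ^ p)
      (boundaryMeasure G o K ε) := fun n =>
    (hu.aestronglyMeasurable.aemeasurable.edist
      (measurable_comp_vertex hG.isTree (cylinderAverage K u) n).aemeasurable).pow_const p
  have hle : ∫⁻ ζ : Boundary G o ε, ∑' n, edist (u ζ) (cylinderAverage K u (ζ.vertex n)) ^ p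
      ∂boundaryMeasure G o K ε ≤ ∑' n, cylinderOsc K p u n := by
    rw [lintegral_tsum hmeas]
    exact ENNReal.tsum_le_tsum fun n => lintegral_edist_cylinderAverage_le hK hG hp hu n
  filter_upwards [ae_lt_top' (AEMeasurable.tsum hmeas) (ne_top_of_le_ne_top hosc hle)]
    with ζ hζ
  have h0 := ENNReal.tendsto_atTop_zero_of_tsum_ne_top hζ.ne
  have h1 := (ENNReal.continuous_rpow_const (y := p⁻¹)).continuousAt.tendsto.comp h0
  rw [ENNReal.zero_rpow_of_pos (inv_pos.2 hp0)] at h1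
  rw [tendsto_iff_edist_tendsto_0]
  refine h1.congr fun n => ?_
  rw [Function.comp_apply, ← ENNReal.rpow_mul, mul_inv_cancel₀ hp0.ne', ENNReal.rpow_one, edist_comm]

theorem isTrace_edgeExtension (hT : G.IsTree) {u : Boundary G o ε → ℝ} {a : V → ℝ}
    (h : ∀ᵐ ζ ∂boundaryMeasure G o K ε, Tendsto (fun n => a (ζ.vertex n)) atTop (𝓝 (u ζ))) :
    IsTrace K (edgeExtension a : Point G o → ℝ) u := by
  rw [IsTrace]
  filter_upwards [h] with ζ hζ
  refine tendsto_ray_of_tendsto_vertexPoint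
    (fun n => edist (a (ζ.vertex (n + 1))) (a (ζ.vertex n))) ?_ (fun n t ht => ?_) (by simpa)
  · have := (hζ.comp (tendsto_add_atTop_nat 1)).edist hζ
    rwa [edist_self] at this
  · have hv : (ζ.ray t).vert = ζ.vertex (n + 1) := by simp [Boundary.ray, ht]
    have h1 := edist_edgeExtension_le hT a (x := ζ.ray t)
      (by rw [hv]; exact ζ.vertex_succ_ne_root n)
    rw [hv, ζ.parent_vertex hT] at h1
    rwa [edgeExtension_vertexPoint]

theorem lintegral_edgeSlope_cylinderAverage_le (hK : 2 ≤ K) (hG : IsKaryTree G o K) {β p θ : ℝ}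
    (hβ : 0 ≤ β) (hp : 1 ≤ p) (hθ : θ * p * ε = p * ε - (β - Real.log K)) (hθ0 : 0 < θ)
    {u : Boundary G o ε → ℝ} (hu : Integrable u (boundaryMeasure G o K ε)) :
    ∫⁻ z : Point G o, edgeSlope ε (cylinderAverage K u) z ^ p ∂treeMeasure G o β ≤
      ENNReal.ofReal (Real.exp (p * ε + Real.log K)) * 2 ^ p *
        ∑' n : ℕ, ENNReal.ofReal (Real.exp (θ * p * ε * n)) * cylinderOsc K p u n := by
  have hε0 := hε.out
  have := hG.countable
  have h2 : (2 : ℝ≥0∞) ^ p = 2 ^ (p - 1) * 2 := by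
    conv_lhs => rw [show p = (p - 1) + 1 by ring, ENNReal.rpow_add _ _ (by simp) (by simp),
      ENNReal.rpow_one]
  refine (lintegral_edgeSlope_rpow_le hK hG hβ hp hθ _).trans ?_
  refine le_trans (mul_le_mul' le_rfl ?_) (le_of_eq (mul_assoc _ _ _).symm)
  -- Both averages are compared with `u ζ` itself.
  have hn : ∀ n : ℕ, ∫⁻ ζ : Boundary G o ε, edist (cylinderAverage K u (ζ.vertex (n + 1)))
      (cylinderAverage K u (ζ.vertex n)) ^ p ∂boundaryMeasure G o K ε ≤
      2 ^ (p - 1) * (cylinderOsc K p u (n + 1) + cylinderOsc K p u n) := by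
    intro n
    calc _ ≤ ∫⁻ ζ : Boundary G o ε, 2 ^ (p - 1) *
          (edist (u ζ) (cylinderAverage K u (ζ.vertex (n + 1))) ^ p +
            edist (u ζ) (cylinderAverage K u (ζ.vertex n)) ^ p) ∂boundaryMeasure G o K ε := by
          refine lintegral_mono fun ζ => le_trans (ENNReal.rpow_le_rpow ?_ (by linarith))
            (add_rpow_le hp _ _)
          exact edist_triangle_left _ _ _
      _ ≤ _ := by
          rw [lintegral_const_mul' _ _ (ENNReal.rpow_ne_top_of_nonneg (by linarith) (by simp)),
            lintegral_add_left' ((hu.aestronglyMeasurable.aemeasurable.edist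
              (measurable_comp_vertex hG.isTree (cylinderAverage K u) (n + 1)).aemeasurable).pow_const
                p)]
          exact mul_le_mul' le_rfl (add_le_add (lintegral_edist_cylinderAverage_le hK hG hp hu _)
            (lintegral_edist_cylinderAverage_le hK hG hp hu _))
  set W : ℕ → ℝ≥0∞ := fun n => ENNReal.ofReal (Real.exp (θ * p * ε * n)) with hW
  -- The weights increase, so the oscillation of level `n + 1` may be charged to its own, larger
  -- weight.
  have hWle : ∀ n, W n ≤ W (n + 1) := by
    intro n
    refine ENNReal.ofReal_le_ofReal (Real.exp_le_exp.2 ?_)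
    have : 0 < θ * p * ε := by positivity
    push_cast
    nlinarith
  calc _ ≤ ∑' n, (2 ^ (p - 1) * (W (n + 1) * cylinderOsc K p u (n + 1)) +
        2 ^ (p - 1) * (W n * cylinderOsc K p u n)) := by
        refine ENNReal.tsum_le_tsum fun n => (mul_le_mul' le_rfl (hn n)).trans ?_
        rw [mul_left_comm, mul_add, mul_add]
        exact add_le_add (mul_le_mul' le_rfl (mul_le_mul' (hWle n) le_rfl)) le_rfl
    _ ≤ 2 ^ (p - 1) * (∑' n, W n * cylinderOsc K p u n) +
          2 ^ (p - 1) * (∑' n, W n * cylinderOsc K p u n) := by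
        rw [ENNReal.tsum_add, ENNReal.tsum_mul_left, ENNReal.tsum_mul_left]
        refine add_le_add (mul_le_mul' le_rfl ?_) le_rfl
        exact ENNReal.tsum_comp_le_tsum_of_injective (add_left_injective 1)
          (fun n => W n * cylinderOsc K p u n)
    _ = _ := by rw [h2]; ring

end Averages
/-! ### Equivalence of the norms -/

section Norms

variable {V : Type*} {G : SimpleGraph V} {o : V} {K : ℕ} {ε : ℝ}

theorem newtonNorm_rpow (ε β : ℝ) {p : ℝ} (hp : 1 ≤ p) (f : Point G o → ℝ) :
    newtonNorm ε β p f ^ p = (∫⁻ x, ENNReal.ofReal |f x| ^ p ∂treeMeasure G o β) +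
      ⨅ (g : Point G o → ℝ≥0∞) (_ : IsUpperGradient ε f g), ∫⁻ x, g x ^ p ∂treeMeasure G o β := by
  rw [newtonNorm, ← ENNReal.rpow_mul, one_div, inv_mul_cancel₀ (by linarith), ENNReal.rpow_one]

theorem le_mul_newtonNorm {β p : ℝ} (hp : 1 ≤ p) {f : Point G o → ℝ} {X C : ℝ≥0∞} (hC0 : C ≠ 0)
    (hC : C ≠ ∞)
    (h : ∀ g, IsUpperGradient ε f g → X ^ p ≤ C *
      ((∫⁻ x, ENNReal.ofReal |f x| ^ p ∂treeMeasure G o β) + ∫⁻ x, g x ^ p ∂treeMeasure G o β)) :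
    X ≤ C ^ p⁻¹ * newtonNorm ε β p f := by
  have hp0 : 0 < p := by linarith
  have h1 : X ^ p ≤ C * newtonNorm ε β p f ^ p := by
    -- The infimum over upper gradients is isolated on the right, so that it can be tested on a
    -- single `g`.
    rw [newtonNorm_rpow ε β hp, mul_comm, ← ENNReal.div_le_iff hC0 hC, ← tsub_le_iff_left]
    refine le_iInf₂ fun g hg => ?_
    rw [tsub_le_iff_left, ENNReal.div_le_iff hC0 hC, mul_comm]
    exact h g hg
  have h2 := ENNReal.rpow_le_rpow h1 (inv_pos.2 hp0).le
  rwa [ENNReal.mul_rpow_of_nonneg _ _ (inv_pos.2 hp0).le, ← ENNReal.rpow_mul, ← ENNReal.rpow_mul,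
    mul_inv_cancel₀ hp0.ne', ENNReal.rpow_one, ENNReal.rpow_one] at h2

variable [hε : Fact (0 < ε)]

theorem eLpNorm_rpow {p : ℝ} (hp : 1 ≤ p) (u : Boundary G o ε → ℝ) :
    eLpNorm u (ENNReal.ofReal p) (boundaryMeasure G o K ε) ^ p =
      ∫⁻ ζ, ‖u ζ‖ₑ ^ p ∂boundaryMeasure G o K ε := by
  have hp0 : 0 < p := by linarith
  rw [eLpNorm_eq_lintegral_rpow_enorm_toReal (by simpa using hp0) ENNReal.ofReal_ne_top,
    ENNReal.toReal_ofReal hp0.le, ← ENNReal.rpow_mul, one_div, inv_mul_cancel₀ hp0.ne',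
    ENNReal.rpow_one]

theorem exists_trace_const (hK : 2 ≤ K) (hG : IsKaryTree G o K) {β p θ : ℝ}
    (hβ : 0 ≤ β) (hp : 1 ≤ p) (hθ : θ * p * ε = p * ε - (β - Real.log K)) (hθ0 : 0 < θ) :
    ∃ C : ℝ≥0∞, C ≠ ∞ ∧ ∀ (f : Point G o → ℝ) (u : Boundary G o ε → ℝ), IsTrace K f u →
      eLpNorm u (ENNReal.ofReal p) (boundaryMeasure G o K ε) ≤ C * newtonNorm ε β p f ∧
      besovSeminorm K θ p p u ≤ C * newtonNorm ε β p f := by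
  have hp0 : 0 < p := by linarith
  have htail := tailConst_ne_top (K := K) (ε := ε) (β := β) hp hθ0
  have h2p : ∀ q : ℝ, 0 ≤ q → (2 : ℝ≥0∞) ^ q ≠ ∞ :=
    fun q hq => ENNReal.rpow_ne_top_of_nonneg hq (by simp)
  set C₁ : ℝ≥0∞ :=
    2 ^ (p - 1) * (2 ^ (p - 1) * ENNReal.ofReal (Real.exp β) ^ 2 + tailConst K ε β p θ) with hC₁
  set C₂ : ℝ≥0∞ :=
    ENNReal.ofReal ((2 / ε) ^ (-(θ * p)) / (θ * p)) * (2 ^ p * tailConst K ε β p θ) with hC₂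
  have h1 : C₁ ≠ ∞ := ENNReal.mul_ne_top (h2p _ (by linarith)) (ENNReal.add_ne_top.2
    ⟨ENNReal.mul_ne_top (h2p _ (by linarith)) (ENNReal.pow_ne_top ENNReal.ofReal_ne_top), htail⟩)
  have h2 : C₂ ≠ ∞ := ENNReal.mul_ne_top ENNReal.ofReal_ne_top
    (ENNReal.mul_ne_top (h2p _ hp0.le) htail)
  have hC : 1 + C₁ + C₂ ≠ ∞ := by simp [h1, h2]
  -- The summand 1 only keeps the constant nonzero, as `le_mul_newtonNorm` divides by it.
  have hC0 : 1 + C₁ + C₂ ≠ 0 := by simp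
  refine ⟨(1 + C₁ + C₂) ^ p⁻¹, ENNReal.rpow_ne_top_of_nonneg (inv_pos.2 hp0).le hC,
    fun f u hu => ⟨le_mul_newtonNorm hp hC0 hC fun g hg => ?_,
      le_mul_newtonNorm hp hC0 hC fun g hg => ?_⟩⟩
  · rw [eLpNorm_rpow hp]
    refine (lintegral_trace_rpow_le hK hG hβ hp hθ hg hu).trans (mul_le_mul' ?_ le_rfl)
    exact le_add_self.trans le_self_add
  · refine (besovSeminorm_trace_le hK hG hβ hp hθ hθ0 hg hu).trans ?_
    exact mul_le_mul' le_add_self le_add_self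

theorem exists_extension_const (hK : 2 ≤ K) (hG : IsKaryTree G o K) {β p θ : ℝ}
    (hβ : Real.log K < β) (hp : 1 ≤ p) (hθ : θ * p * ε = p * ε - (β - Real.log K)) (hθ0 : 0 < θ) :
    ∃ C : ℝ≥0∞, C ≠ ∞ ∧ ∀ u ∈ besovSpace G o K ε θ p p,
      ∃ f ∈ newtonSpace G o ε β p, IsTrace K f u ∧
        newtonNorm ε β p f ≤ C * besovNorm K θ p p u := by
  have hε0 := hε.out
  have hT := hG.isTree
  have hp0 : 0 < p := by linarith
  have hβ0 : 0 ≤ β := (Real.log_natCast_nonneg K).trans hβ.le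
  have hprob := isProbabilityMeasure_boundaryMeasure (ε := ε) hK hG
  have h2p : (2 : ℝ≥0∞) ^ p ≠ ∞ := ENNReal.rpow_ne_top_of_nonneg hp0.le (by simp)
  set c : ℝ≥0∞ := ENNReal.ofReal ((2 / ε * Real.exp ε) ^ (-(θ * p)) * (1 - Real.exp (-ε))) with hc
  have hc0 : c ≠ 0 := by
    have : Real.exp (-ε) < 1 := by rw [Real.exp_lt_one_iff]; linarith
    have : 0 < 1 - Real.exp (-ε) := by linarith
    exact (ENNReal.ofReal_pos.2 (by positivity)).ne'
  set D₁ : ℝ≥0∞ :=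
    2 ^ p * K * (∑' n : ℕ, ENNReal.ofReal (Real.exp (-(β - Real.log K))) ^ n) with hD₁
  set D₂ : ℝ≥0∞ := ENNReal.ofReal (Real.exp (p * ε + Real.log K)) * 2 ^ p * c⁻¹ with hD₂
  have h1 : D₁ ≠ ∞ := by
    refine ENNReal.mul_ne_top (ENNReal.mul_ne_top h2p (ENNReal.natCast_ne_top K)) ?_
    rw [ENNReal.tsum_geometric, ENNReal.inv_ne_top, Ne, tsub_eq_zero_iff_le, not_le,
      ENNReal.ofReal_lt_one, Real.exp_lt_one_iff]
    linarith
  have h2 : D₂ ≠ ∞ := ENNReal.mul_ne_top (ENNReal.mul_ne_top ENNReal.ofReal_ne_top h2p)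
    (ENNReal.inv_ne_top.2 hc0)
  refine ⟨(D₁ + D₂) ^ p⁻¹, ENNReal.rpow_ne_top_of_nonneg (inv_pos.2 hp0).le (by simp [h1, h2]),
    fun u hu => ?_⟩
  obtain ⟨hmem, hsemi⟩ := hu
  have hint : Integrable u (boundaryMeasure G o K ε) :=
    hmem.integrable (by rwa [ENNReal.one_le_ofReal])
  have hum := hint.aestronglyMeasurable.aemeasurable
  set a := cylinderAverage K u with ha
  set Sm : ℝ≥0∞ :=
    ∑' n : ℕ, ENNReal.ofReal (Real.exp (θ * p * ε * n)) * cylinderOsc K p u n with hSm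
  have hosc : Sm ≤ c⁻¹ * besovSeminorm K θ p p u ^ p := by
    have h3 := tsum_cylinderOsc_le (K := K) hT hp hθ0 u
    rwa [mul_comm c⁻¹, ← div_eq_mul_inv, ENNReal.le_div_iff_mul_le (Or.inl hc0)
      (Or.inl ENNReal.ofReal_ne_top), mul_comm]
  have hsemi' : besovSeminorm K θ p p u ^ p ≠ ∞ := ENNReal.rpow_ne_top_of_nonneg hp0.le hsemi.ne
  -- The weights `e^{θpεn}` are at least 1, so finiteness of the weighted sum suffices.
  have hoscfin : ∑' n, cylinderOsc K p u n ≠ ∞ := by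
    refine ne_top_of_le_ne_top (ENNReal.mul_ne_top (ENNReal.inv_ne_top.2 hc0) hsemi')
      (le_trans (ENNReal.tsum_le_tsum fun n => ?_) hosc)
    refine le_mul_of_one_le_left' ?_
    rw [ENNReal.one_le_ofReal, Real.one_le_exp_iff]
    positivity
  have hf : newtonNorm ε β p (edgeExtension a : Point G o → ℝ) ^ p ≤
      (D₁ + D₂) * besovNorm K θ p p u ^ p := by
    rw [newtonNorm_rpow ε β hp, add_mul]
    refine add_le_add ?_ ((iInf₂_le _ (isUpperGradient_edgeSlope hT a)).trans ?_)
    · refine (lintegral_edgeExtension_rpow_le hK hG hβ0 hp a fun n =>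
        lintegral_cylinderAverage_rpow_le hK hG hp hum n).trans (mul_le_mul' le_rfl ?_)
      rw [← eLpNorm_rpow hp]
      exact ENNReal.rpow_le_rpow le_self_add hp0.le
    · refine (lintegral_edgeSlope_cylinderAverage_le hK hG hβ0 hp hθ hθ0 hint).trans
        ((mul_le_mul' le_rfl hosc).trans ?_)
      rw [← mul_assoc]
      exact mul_le_mul' le_rfl (ENNReal.rpow_le_rpow le_add_self hp0.le)
  have hf' : newtonNorm ε β p (edgeExtension a : Point G o → ℝ) ≤
      (D₁ + D₂) ^ p⁻¹ * besovNorm K θ p p u := by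
    have h4 := ENNReal.rpow_le_rpow hf (inv_pos.2 hp0).le
    rwa [ENNReal.mul_rpow_of_nonneg _ _ (inv_pos.2 hp0).le, ← ENNReal.rpow_mul,
      ← ENNReal.rpow_mul, mul_inv_cancel₀ hp0.ne', ENNReal.rpow_one, ENNReal.rpow_one] at h4
  refine ⟨edgeExtension a, ⟨(measurable_edgeExtension a).aemeasurable, hf'.trans_lt ?_⟩,
    isTrace_edgeExtension hT (ae_tendsto_cylinderAverage hK hG hp hint hoscfin), hf'⟩
  refine ENNReal.mul_lt_top ?_ (ENNReal.add_lt_top.2 ⟨hmem.2, hsemi⟩)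
  exact (ENNReal.rpow_ne_top_of_nonneg (inv_pos.2 hp0).le (by simp [h1, h2])).lt_top

end Norms

end KTree

end

/-! ### The trace theorem. -/

theorem theorem6p4 {V : Type*} (G : SimpleGraph V) (o : V) (K : ℕ) (hK : 2 ≤ K)
    (hG : KTree.IsKaryTree G o K) (ε β p θ : ℝ) [Fact (0 < ε)] (hβ : Real.log K < β)
    (hp : 1 ≤ p) (hθ : θ = 1 - (β - Real.log K) / (p * ε)) (hθ_pos : 0 < θ) :
    (∀ f ∈ KTree.newtonSpace G o ε β p, ∃ u : KTree.Boundary G o ε → ℝ, KTree.IsTrace K f u) ∧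
    KTree.traceSpace G o K ε β p = KTree.besovSpace G o K ε θ p p ∧
    ∃ C : ℝ≥0, ∀ u ∈ KTree.besovSpace G o K ε θ p p,
      KTree.besovNorm K θ p p u ≤ C * KTree.traceNorm K β p u ∧
      KTree.traceNorm K β p u ≤ C * KTree.besovNorm K θ p p u := by
  have hε0 : 0 < ε := Fact.out
  have hp0 : 0 < p := by linarith
  have hβ0 : 0 ≤ β := (Real.log_natCast_nonneg K).trans hβ.le
  have hθ' : θ * p * ε = p * ε - (β - Real.log K) := by
    rw [hθ]
    field_simp
  obtain ⟨C₁, hC₁, h1⟩ := KTree.exists_trace_const hK hG hβ0 hp hθ' hθ_pos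
  obtain ⟨C₂, hC₂, h2⟩ := KTree.exists_extension_const hK hG hβ hp hθ' hθ_pos
  have := hG.countable
  -- `2 * C₁` serves the two summands of the Besov norm, `C₂` the extension, and 1 makes the
  -- constant nonzero so that it can be divided out under the infimum.
  refine ⟨fun f hf => ?_, Subset.antisymm ?_ ?_, (1 + 2 * C₁ + C₂).toNNReal, fun u hu => ?_⟩
  · have hlt : KTree.newtonNorm ε β p f ^ p < ∞ := ENNReal.rpow_lt_top_of_nonneg hp0.le hf.2.ne
    rw [KTree.newtonNorm_rpow ε β hp, ENNReal.add_lt_top] at hlt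
    -- A finite infimum provides an upper gradient of finite energy.
    obtain ⟨g, hg⟩ := iInf_lt_iff.1 hlt.2
    obtain ⟨hug, hgp⟩ := iInf_lt_iff.1 hg
    exact KTree.exists_isTrace hK hG hβ0 hp hθ' hθ_pos hug hgp.ne
  · rintro u ⟨f, hf, hu⟩
    obtain ⟨h3, h4⟩ := h1 f u hu
    have hfin := ENNReal.mul_lt_top hC₁.lt_top hf.2
    exact ⟨⟨(hu.aemeasurable hG.isTree).aestronglyMeasurable, h3.trans_lt hfin⟩,
      h4.trans_lt hfin⟩
  · intro u hu
    obtain ⟨f, hf, hfu, -⟩ := h2 u hu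
    exact ⟨f, hf, hfu⟩
  · rw [ENNReal.coe_toNNReal (by finiteness)]
    constructor
    · rw [mul_comm, ← ENNReal.div_le_iff (by simp) (by finiteness)]
      refine le_iInf₂ fun f hf => ?_
      rw [ENNReal.div_le_iff (by simp) (by finiteness), mul_comm]
      obtain ⟨h3, h4⟩ := h1 f u hf.2
      calc KTree.besovNorm K θ p p u
          ≤ C₁ * KTree.newtonNorm ε β p f + C₁ * KTree.newtonNorm ε β p f := add_le_add h3 h4
        _ = 2 * C₁ * KTree.newtonNorm ε β p f := by ring
        _ ≤ _ := mul_le_mul' (le_add_self.trans le_self_add) le_rfl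
    · obtain ⟨f, hf, hfu, hle⟩ := h2 u hu
      exact (iInf₂_le f ⟨hf, hfu⟩).trans (hle.trans (mul_le_mul' le_add_self le_rfl))
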